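/- Let $n_1,n_2,n_3\ge 1$, $n=n_1+n_2+n_3$, $G=\mathrm{SO}(n)$, and let $H=\mathrm{SO}(n_1)\cdot\mathrm{SO}(n_2)\cdot\mathrm{SO}(n_3)$ be embedded in $G$ block-diagonally. Let $B(X,Y)=-\operatorname{tr}(XY)$, let $\mathfrak m$ be the $B$-orthogonal complement of $\mathfrak h=\operatorname{Lie}(H)$ in $\mathfrak{so}(n)$, identified with $T_o(G/H)$, $o=eH$, and let $Z\mapsto Z_{\mathfrak m}$ be the $B$-orthogonal projection $\mathfrak{so}(n)\to\mathfrak m$. Let $\xi_{kl}=E_{kl}-E_{lk}$, let $$I_1=\{1,\dots,n_1\},\quad I_2=\{n_1+1,\dots,n_1+n_2\},\quad I_3=\{n_1+n_2+1,\dots,n\},$$ and for $1\le i<j\le 3$ let $\mathfrak m_{ij}=\operatorname{span}\{\xi_{kl}:k\in I_i,\ l\in I_j\}$, so that $\mathfrak m=\mathfrak m_{12}\oplus\mathfrak m_{13}\oplus\mathfrak m_{23}$. The $G$-invariant Riemannian metrics on $G/H$ correspond to the operators $\Lambda:\mathfrak m\to\mathfrak m$ that are $B$-symmetric, positive definite and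 $\mathrm{Ad}(H)$-equivariant, through $\langle X,Y\rangle=B(\Lambda X,Y)$ at $o$; among them is the family $\Lambda=\lambda_{12}\mathrm{Id}_{\mathfrak m_{12}}+\lambda_{13}\mathrm{Id}_{\mathfrak m_{13}}+\lambda_{23}\mathrm{Id}_{\mathfrak m_{23}}$ with $\lambda_{12},\lambda_{13},\lambda_{23}>0$. Let $X=X_{12}+X_{13}+X_{23}\in\mathfrak m$ with $X_{ij}=\sum_{k\in I_i,\,l\in I_j}a_{kl}\,\xi_{kl}$, $a_{kl}\in\mathbb R$. Consider the system (A) $\displaystyle\sum_{i\in I_1,\,j\in I_2}\ \sum_{k\in I_1,\,l\in I_3}a_{ij}a_{kl}\,B([\xi_{ij},\xi_{pq}]_{\mathfrak m},\xi_{kl})=0$ for all $p\in I_2,\ q\in I_3$; (B) $\displaystyle\sum_{i\in I_1,\,j\in I_2}\ \sum_{k\in I_2,\,l\in I_3}a_{ij}a_{kl}\,B([\xi_{ij},\xi_{pq}]_{\mathfrak m},\xi_{kl})=0$ for all $p\in I_1,\ q\in I_3$; (C) $\displaystyle\sum_{i\in I_1,\,j\in I_3}\ \sum_{k\in I_2,\,l\in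 I_3}a_{ij}a_{kl}\,B([\xi_{ij},\xi_{pq}]_{\mathfrak m},\xi_{kl})=0$ for all $p\in I_1,\ q\in I_2$. Then: 1. The curve $\gamma(t)=\exp(tX)\cdot o$ is a geodesic of $G/H$ for every metric of the family $\lambda_{12}\mathrm{Id}_{\mathfrak m_{12}}+\lambda_{13}\mathrm{Id}_{\mathfrak m_{13}}+\lambda_{23}\mathrm{Id}_{\mathfrak m_{23}}$ if and only if (A), (B) and (C) hold. 2. If moreover at most one of $n_1,n_2,n_3$ equals $1$ and at most one of them equals $2$, then $X$ is an equigeodesic vector, that is, $\gamma(t)=\exp(tX)\cdot o$ is a geodesic of $G/H$ for every $G$-invariant Riemannian metric, if and only if (A), (B) and (C) hold. -/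

import Mathlib

open Matrix
open scoped ContDiff

noncomputable section

namespace GenWallach

/-- Real `n × n` matrices, `n = n₁ + n₂ + n₃`. -/
abbrev Mat (n₁ n₂ n₃ : ℕ) := Matrix (Fin (n₁ + n₂ + n₃)) (Fin (n₁ + n₂ + n₃)) ℝ

/-- The block to which an index belongs: blocks `0, 1, 2` of `Fin 3` have sizes `n₁, n₂, n₃`. -/
def block (n₁ n₂ n₃ : ℕ) (k : Fin (n₁ + n₂ + n₃)) : Fin 3 :=
  if (k : ℕ) < n₁ then 0 else if (k : ℕ) < n₁ + n₂ then 1 else 2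

/-- The set of indices of a given block. -/
def I (n₁ n₂ n₃ : ℕ) (r : Fin 3) : Finset (Fin (n₁ + n₂ + n₃)) :=
  Finset.univ.filter fun k => block n₁ n₂ n₃ k = r

/-- `ξ k l = E_{kl} - E_{lk}`. -/
def ξ {n₁ n₂ n₃ : ℕ} (k l : Fin (n₁ + n₂ + n₃)) : Mat n₁ n₂ n₃ :=
  Matrix.single k l 1 - Matrix.single l k 1

/-- `B(X, Y) = - tr (X Y)`. -/
def B {n₁ n₂ n₃ : ℕ} (X Y : Mat n₁ n₂ n₃) : ℝ := -(X * Y).trace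

/-- The group `SO(n₁ + n₂ + n₃)`. -/
abbrev G (n₁ n₂ n₃ : ℕ) := Matrix.specialOrthogonalGroup (Fin (n₁ + n₂ + n₃)) ℝ

theorem transpose_mul_self {n₁ n₂ n₃ : ℕ} (g : G n₁ n₂ n₃) :
    (g : Mat n₁ n₂ n₃)ᵀ * (g : Mat n₁ n₂ n₃) = 1 :=
  (Matrix.mem_orthogonalGroup_iff' (Fin (n₁ + n₂ + n₃)) ℝ).1
    (Matrix.mem_specialOrthogonalGroup_iff.1 g.2).1

theorem mul_transpose_self {n₁ n₂ n₃ : ℕ} (g : G n₁ n₂ n₃) :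
    (g : Mat n₁ n₂ n₃) * (g : Mat n₁ n₂ n₃)ᵀ = 1 :=
  (Matrix.mem_orthogonalGroup_iff (Fin (n₁ + n₂ + n₃)) ℝ).1
    (Matrix.mem_specialOrthogonalGroup_iff.1 g.2).1

theorem coe_inv {n₁ n₂ n₃ : ℕ} (g : G n₁ n₂ n₃) :
    ((g⁻¹ : G n₁ n₂ n₃) : Mat n₁ n₂ n₃) = (g : Mat n₁ n₂ n₃)ᵀ := rfl

/-- A matrix whose only non-zero entries lie in the three diagonal blocks. -/
def IsBlockDiag {n₁ n₂ n₃ : ℕ} (A : Mat n₁ n₂ n₃) : Prop :=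
  ∀ k l, block n₁ n₂ n₃ k ≠ block n₁ n₂ n₃ l → A k l = 0

theorem IsBlockDiag.toSquareBlock_mul {n₁ n₂ n₃ : ℕ} {A : Mat n₁ n₂ n₃}
    (hA : IsBlockDiag A) (C : Mat n₁ n₂ n₃) (r : Fin 3) :
    (A * C).toSquareBlock (block n₁ n₂ n₃) r =
      A.toSquareBlock (block n₁ n₂ n₃) r * C.toSquareBlock (block n₁ n₂ n₃) r := by
  ext k l
  change ∑ j, A k.1 j * C j l.1 =
    ∑ j : {a // block n₁ n₂ n₃ a = r}, A k.1 j.1 * C j.1 l.1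
  rw [← Finset.sum_subtype (I n₁ n₂ n₃ r) (fun x => by simp [I])
    (fun j => A k.1 j * C j l.1)]
  refine (Finset.sum_subset (Finset.subset_univ _) fun j _ hj => ?_).symm
  rw [hA k.1 j (fun h => hj (by simp [I, ← h, k.2])), zero_mul]

theorem IsBlockDiag.mul {n₁ n₂ n₃ : ℕ} {A C : Mat n₁ n₂ n₃}
    (hA : IsBlockDiag A) (hC : IsBlockDiag C) : IsBlockDiag (A * C) := by
  intro k l hkl
  rw [Matrix.mul_apply]
  refine Finset.sum_eq_zero fun j _ => ?_
  by_cases h : block n₁ n₂ n₃ k = block n₁ n₂ n₃ j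
  · rw [hC j l (by rw [← h]; exact hkl), mul_zero]
  · rw [hA k j h, zero_mul]

/-- The subgroup `SO(n₁) · SO(n₂) · SO(n₃)`, embedded diagonally: the block diagonal matrices
whose three diagonal blocks are special orthogonal. -/
def H (n₁ n₂ n₃ : ℕ) : Subgroup (G n₁ n₂ n₃) where
  carrier := {g | IsBlockDiag (g : Mat n₁ n₂ n₃) ∧
    ∀ r, (g : Mat n₁ n₂ n₃).toSquareBlock (block n₁ n₂ n₃) r ∈
      Matrix.specialOrthogonalGroup {k // block n₁ n₂ n₃ k = r} ℝ}
  mul_mem' := by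
    rintro g h ⟨hg, hg'⟩ ⟨hh, hh'⟩
    refine ⟨hg.mul hh, fun r => ?_⟩
    have e := hg.toSquareBlock_mul (h : Mat n₁ n₂ n₃) r
    have m := mul_mem (hg' r) (hh' r)
    rw [← e] at m
    exact m
  one_mem' := by
    refine ⟨fun k l hkl => Matrix.one_apply_ne (fun h => hkl (by rw [h])), fun r => ?_⟩
    have e : ((1 : G n₁ n₂ n₃) : Mat n₁ n₂ n₃).toSquareBlock (block n₁ n₂ n₃) r = 1 := by
      ext k l
      change (1 : Mat n₁ n₂ n₃) k.1 l.1 = _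
      simp [Matrix.one_apply, Subtype.ext_iff]
    rw [e]
    exact one_mem _
  inv_mem' := by
    rintro g ⟨hg, hg'⟩
    refine ⟨fun k l hkl => hg l k (Ne.symm hkl), fun r => ?_⟩
    exact Matrix.mem_specialOrthogonalGroup_iff.2
      ⟨(Matrix.mem_orthogonalGroup_iff _ ℝ).2
        ((Matrix.mem_orthogonalGroup_iff' _ ℝ).1
          (Matrix.mem_specialOrthogonalGroup_iff.1 (hg' r)).1),
        (Matrix.det_transpose _).trans (Matrix.mem_specialOrthogonalGroup_iff.1 (hg' r)).2⟩

/-- `𝔪`, the `B`-orthogonal complement of `𝔥` in `𝔰𝔬(n)`: the skew-symmetric matrices whose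
three diagonal blocks vanish. -/
def 𝔪 (n₁ n₂ n₃ : ℕ) : Submodule ℝ (Mat n₁ n₂ n₃) where
  carrier := {X | Xᵀ = -X ∧ ∀ k l, block n₁ n₂ n₃ k = block n₁ n₂ n₃ l → X k l = 0}
  zero_mem' := by simp
  add_mem' := by
    rintro X Y ⟨hX, hX'⟩ ⟨hY, hY'⟩
    refine ⟨by rw [Matrix.transpose_add, hX, hY]; abel, fun k l h => ?_⟩
    simp [hX' k l h, hY' k l h]
  smul_mem' := by
    rintro c X ⟨hX, hX'⟩
    refine ⟨by rw [Matrix.transpose_smul, hX, smul_neg], fun k l h => ?_⟩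
    simp [hX' k l h]

/-- The `B`-orthogonal projection onto `𝔪`, written `Z ↦ Z_𝔪`. On a skew-symmetric `Z` it
replaces the three diagonal blocks by `0`; a general matrix is first replaced by its
skew-symmetric part. -/
def projM (n₁ n₂ n₃ : ℕ) : Mat n₁ n₂ n₃ →ₗ[ℝ] 𝔪 n₁ n₂ n₃ where
  toFun Z := ⟨Matrix.of fun k l =>
      if block n₁ n₂ n₃ k = block n₁ n₂ n₃ l then 0 else (Z k l - Z l k) / 2, by
    refine ⟨?_, fun k l h => by simp [h]⟩
    ext k l
    by_cases h : block n₁ n₂ n₃ k = block n₁ n₂ n₃ l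
    · simp [h]
    · simp [h, Ne.symm h]; ring⟩
  map_add' Z W := by
    ext k l
    by_cases h : block n₁ n₂ n₃ k = block n₁ n₂ n₃ l
    · simp [h]
    · simp [h]; ring
  map_smul' c Z := by
    ext k l
    by_cases h : block n₁ n₂ n₃ k = block n₁ n₂ n₃ l
    · simp [h]
    · simp [h]; ring

theorem conj_apply {n₁ n₂ n₃ : ℕ} (h X : Mat n₁ n₂ n₃) (k l : Fin (n₁ + n₂ + n₃)) :
    (h * X * hᵀ) k l = ∑ j, ∑ i, h k i * X i j * h l j := by
  simp [Matrix.mul_apply, Finset.sum_mul]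

/-- `Ad(h) X = h X h⁻¹` for `h ∈ H`, `X ∈ 𝔪`, as a linear map of `𝔪`. -/
def Ad {n₁ n₂ n₃ : ℕ} (h : H n₁ n₂ n₃) : 𝔪 n₁ n₂ n₃ →ₗ[ℝ] 𝔪 n₁ n₂ n₃ where
  toFun X := ⟨(h.1 : Mat n₁ n₂ n₃) * (X : Mat n₁ n₂ n₃) * ((h.1)⁻¹ : G n₁ n₂ n₃), by
    rw [coe_inv]
    refine ⟨?_, fun k l hkl => ?_⟩
    · rw [Matrix.transpose_mul, Matrix.transpose_mul, Matrix.transpose_transpose, X.2.1,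
        Matrix.neg_mul, Matrix.mul_neg, Matrix.mul_assoc]
    · rw [conj_apply]
      refine Finset.sum_eq_zero fun j _ => Finset.sum_eq_zero fun i _ => ?_
      by_cases h1 : block n₁ n₂ n₃ k = block n₁ n₂ n₃ i
      · by_cases h2 : block n₁ n₂ n₃ l = block n₁ n₂ n₃ j
        · rw [X.2.2 i j (by rw [← h1, ← h2, hkl])]; ring
        · rw [h.2.1 l j h2]; ring
      · rw [h.2.1 k i h1]; ring⟩
  map_add' X Y := by
    ext1; simp [Matrix.mul_add, Matrix.add_mul]
  map_smul' c X := by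
    ext1; simp

/-- A `G`-invariant Riemannian metric on `G/H`, given by its operator `Λ` on `𝔪 = T_o(G/H)`:
the inner product at `o` is `⟨X, Y⟩ = B(Λ X, Y)`. -/
structure InvariantMetric (n₁ n₂ n₃ : ℕ) where
  Λ : 𝔪 n₁ n₂ n₃ →ₗ[ℝ] 𝔪 n₁ n₂ n₃
  symm : ∀ X Y : 𝔪 n₁ n₂ n₃, B (Λ X : Mat n₁ n₂ n₃) Y = B (X : Mat n₁ n₂ n₃) (Λ Y)
  pos : ∀ X : 𝔪 n₁ n₂ n₃, X ≠ 0 → 0 < B (Λ X : Mat n₁ n₂ n₃) X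
  equivariant : ∀ (h : H n₁ n₂ n₃) (X : 𝔪 n₁ n₂ n₃), Ad h (Λ X) = Λ (Ad h X)

/-- The value attached to an unordered pair of distinct blocks. -/
def pairWeight (c₁₂ c₁₃ c₂₃ : ℝ) (r s : Fin 3) : ℝ :=
  if r ≠ 2 ∧ s ≠ 2 then c₁₂ else if r ≠ 1 ∧ s ≠ 1 then c₁₃ else c₂₃

theorem pairWeight_comm (c₁₂ c₁₃ c₂₃ : ℝ) (r s : Fin 3) :
    pairWeight c₁₂ c₁₃ c₂₃ r s = pairWeight c₁₂ c₁₃ c₂₃ s r := by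
  simp only [pairWeight, and_comm]

theorem pairWeight_pos {c₁₂ c₁₃ c₂₃ : ℝ} (h₁₂ : 0 < c₁₂) (h₁₃ : 0 < c₁₃) (h₂₃ : 0 < c₂₃)
    (r s : Fin 3) : 0 < pairWeight c₁₂ c₁₃ c₂₃ r s := by
  unfold pairWeight; split_ifs <;> assumption

/-- The operator `c₁₂ Id + c₁₃ Id + c₂₃ Id` on `𝔪 = 𝔪₁₂ ⊕ 𝔪₁₃ ⊕ 𝔪₂₃`. -/
def diagOp (n₁ n₂ n₃ : ℕ) (c₁₂ c₁₃ c₂₃ : ℝ) : 𝔪 n₁ n₂ n₃ →ₗ[ℝ] 𝔪 n₁ n₂ n₃ where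
  toFun X := ⟨Matrix.of fun k l =>
      pairWeight c₁₂ c₁₃ c₂₃ (block n₁ n₂ n₃ k) (block n₁ n₂ n₃ l) * (X : Mat n₁ n₂ n₃) k l, by
    refine ⟨?_, fun k l h => ?_⟩
    · ext k l
      have := congrFun (congrFun X.2.1 k) l
      simp only [Matrix.transpose_apply, Matrix.neg_apply] at this
      simp only [Matrix.transpose_apply, Matrix.neg_apply, Matrix.of_apply, this]
      rw [pairWeight_comm]; ring
    · simp [X.2.2 k l h]⟩
  map_add' X Y := by
    ext k l; simp [mul_add]
  map_smul' c X := by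
    ext k l; simp; ring

theorem B_apply {n₁ n₂ n₃ : ℕ} (X Y : Mat n₁ n₂ n₃) :
    B X Y = -∑ k, ∑ l, X k l * Y l k := by
  simp [B, Matrix.trace, Matrix.mul_apply]

/-- The three-parameter family `Λ = c₁₂ Id_{𝔪₁₂} + c₁₃ Id_{𝔪₁₃} + c₂₃ Id_{𝔪₂₃}` of invariant
metrics. -/
def wallachMetric (n₁ n₂ n₃ : ℕ) (c₁₂ c₁₃ c₂₃ : ℝ) (h₁₂ : 0 < c₁₂) (h₁₃ : 0 < c₁₃)
    (h₂₃ : 0 < c₂₃) : InvariantMetric n₁ n₂ n₃ where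
  Λ := diagOp n₁ n₂ n₃ c₁₂ c₁₃ c₂₃
  symm X Y := by
    simp only [B_apply, diagOp, LinearMap.coe_mk, AddHom.coe_mk, Matrix.of_apply]
    refine congrArg _ (Finset.sum_congr rfl fun k _ => Finset.sum_congr rfl fun l _ => ?_)
    rw [pairWeight_comm]; ring
  pos X hX := by
    have e : B (diagOp n₁ n₂ n₃ c₁₂ c₁₃ c₂₃ X : Mat n₁ n₂ n₃) X =
        ∑ k, ∑ l, pairWeight c₁₂ c₁₃ c₂₃ (block n₁ n₂ n₃ k) (block n₁ n₂ n₃ l) *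
          (X : Mat n₁ n₂ n₃) k l ^ 2 := by
      simp only [B_apply, diagOp, LinearMap.coe_mk, AddHom.coe_mk, Matrix.of_apply,
        ← Finset.sum_neg_distrib]
      refine Finset.sum_congr rfl fun k _ => Finset.sum_congr rfl fun l _ => ?_
      have := congrFun (congrFun X.2.1 k) l
      simp only [Matrix.transpose_apply, Matrix.neg_apply] at this
      rw [this]; ring
    rw [e]
    have nn : ∀ k l, 0 ≤ pairWeight c₁₂ c₁₃ c₂₃ (block n₁ n₂ n₃ k) (block n₁ n₂ n₃ l) *
        (X : Mat n₁ n₂ n₃) k l ^ 2 := fun k l =>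
      mul_nonneg (pairWeight_pos h₁₂ h₁₃ h₂₃ _ _).le (sq_nonneg _)
    refine lt_of_le_of_ne (Finset.sum_nonneg fun k _ => Finset.sum_nonneg fun l _ => nn k l) ?_
    intro h0
    apply hX
    ext k l
    have h1 := (Finset.sum_eq_zero_iff_of_nonneg fun k _ =>
      Finset.sum_nonneg fun l _ => nn k l).1 h0.symm k (Finset.mem_univ k)
    have h2 := (Finset.sum_eq_zero_iff_of_nonneg fun l _ => nn k l).1 h1 l (Finset.mem_univ l)
    have h3 := (mul_eq_zero.1 h2).resolve_left (pairWeight_pos h₁₂ h₁₃ h₂₃ _ _).ne'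
    simpa using h3
  equivariant h X := by
    ext k l
    simp only [Ad, diagOp, LinearMap.coe_mk, AddHom.coe_mk, Matrix.of_apply, coe_inv, conj_apply,
      Finset.mul_sum]
    refine Finset.sum_congr rfl fun j _ => Finset.sum_congr rfl fun i _ => ?_
    by_cases h1 : block n₁ n₂ n₃ k = block n₁ n₂ n₃ i
    · by_cases h2 : block n₁ n₂ n₃ l = block n₁ n₂ n₃ j
      · rw [h1, h2]; ring
      · rw [h.2.1 l j h2]; ring
    · rw [h.2.1 k i h1]; ring

/-- Smooth maps into `SO(n)`, viewed inside the space of all matrices. -/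
def SmoothLift {n₁ n₂ n₃ : ℕ} {E : Type*} [NormedAddCommGroup E] [NormedSpace ℝ E]
    (g : E → G n₁ n₂ n₃) : Prop :=
  ∀ k l, ContDiff ℝ ∞ fun p => (g p : Mat n₁ n₂ n₃) k l

/-- The velocity at time `t` of the curve `t ↦ g(t) H` in `G/H`, moved to the origin `o` by the
differential of the action of `g(t)⁻¹` and read in `𝔪 = T_o(G/H)`: the vector
`(g(t)⁻¹ g'(t))_𝔪`. -/
def velocity {n₁ n₂ n₃ : ℕ} (g : ℝ → G n₁ n₂ n₃) (t : ℝ) : 𝔪 n₁ n₂ n₃ :=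
  projM n₁ n₂ n₃ (((g t)⁻¹ : G n₁ n₂ n₃) *
    Matrix.of fun k l => deriv (fun u => (g u : Mat n₁ n₂ n₃) k l) t)

/-- The energy `½ ∫ ‖c'(t)‖² dt` over `[a, b]`, for the invariant metric `M`, of the curve
`c(t) = g(t) H` in `G/H`; it does not depend on the lift `g`, as `M.Λ` is `Ad(H)`-equivariant. -/
def energy {n₁ n₂ n₃ : ℕ} (M : InvariantMetric n₁ n₂ n₃) (g : ℝ → G n₁ n₂ n₃) (a b : ℝ) : ℝ :=
  (1 / 2) * ∫ t in a..b, B (M.Λ (velocity g t) : Mat n₁ n₂ n₃) (velocity g t)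

/-- A smooth curve `γ` in `G/H` is a geodesic of the invariant metric `M` if on every compact
interval `[a, b]` it is a critical point of the energy among the smooth variations
`(s, t) ↦ g(s, t) H` of `γ` that fix the end points. -/
def IsGeodesic {n₁ n₂ n₃ : ℕ} (M : InvariantMetric n₁ n₂ n₃)
    (γ : ℝ → G n₁ n₂ n₃ ⧸ H n₁ n₂ n₃) : Prop :=
  (∃ g : ℝ → G n₁ n₂ n₃, SmoothLift g ∧ ∀ t, (g t : G n₁ n₂ n₃ ⧸ H n₁ n₂ n₃) = γ t) ∧
  ∀ a b : ℝ, a < b → ∀ g : ℝ × ℝ → G n₁ n₂ n₃, SmoothLift g →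
    (∀ t ∈ Set.Icc a b, (g (0, t) : G n₁ n₂ n₃ ⧸ H n₁ n₂ n₃) = γ t) →
    (∀ s, (g (s, a) : G n₁ n₂ n₃ ⧸ H n₁ n₂ n₃) = γ a ∧
      (g (s, b) : G n₁ n₂ n₃ ⧸ H n₁ n₂ n₃) = γ b) →
    HasDerivAt (fun s => energy M (fun t => g (s, t)) a b) 0 0

/-- `exp X`, the matrix exponential of a skew-symmetric matrix, as an element of `SO(n)`. -/
def expG {n₁ n₂ n₃ : ℕ} (X : 𝔪 n₁ n₂ n₃) : G n₁ n₂ n₃ :=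
  ⟨NormedSpace.exp (X : Mat n₁ n₂ n₃), by
    have key : ∀ Y : Mat n₁ n₂ n₃, Yᵀ = -Y →
        NormedSpace.exp Y * (NormedSpace.exp Y)ᵀ = 1 := by
      intro Y hY
      rw [← Matrix.exp_transpose, hY, ← Matrix.exp_add_of_commute _ _ (Commute.neg_right (Commute.refl Y))]
      simp
    refine Matrix.mem_specialOrthogonalGroup_iff.2
      ⟨(Matrix.mem_orthogonalGroup_iff _ ℝ).2 (key _ X.2.1), ?_⟩
    have hY := key ((1 / 2 : ℝ) • (X : Mat n₁ n₂ n₃))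
      (by rw [Matrix.transpose_smul, X.2.1, smul_neg])
    have hd := congrArg Matrix.det hY
    rw [Matrix.det_mul, Matrix.det_transpose, Matrix.det_one] at hd
    have e : (X : Mat n₁ n₂ n₃) =
        (1 / 2 : ℝ) • (X : Mat n₁ n₂ n₃) + (1 / 2 : ℝ) • (X : Mat n₁ n₂ n₃) := by
      rw [← add_smul]; norm_num
    rw [e, Matrix.exp_add_of_commute _ _ rfl, Matrix.det_mul, hd]⟩

/-- The curve `t ↦ exp(t X) · o` in `G/H`, where `o = eH`. -/
def orbitCurve {n₁ n₂ n₃ : ℕ} (X : 𝔪 n₁ n₂ n₃) (t : ℝ) : G n₁ n₂ n₃ ⧸ H n₁ n₂ n₃ :=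
  (expG (t • X) : G n₁ n₂ n₃)

/-- `X` is an equigeodesic vector: `exp(t X) · o` is a geodesic of every `G`-invariant metric. -/
def IsEquigeodesicVector {n₁ n₂ n₃ : ℕ} (X : 𝔪 n₁ n₂ n₃) : Prop :=
  ∀ M : InvariantMetric n₁ n₂ n₃, IsGeodesic M (orbitCurve X)

/-- `X` is equigeodesic for the three-parameter family of diagonal invariant metrics. -/
def IsWallachEquigeodesicVector {n₁ n₂ n₃ : ℕ} (X : 𝔪 n₁ n₂ n₃) : Prop :=
  ∀ (c₁₂ c₁₃ c₂₃ : ℝ) (h₁₂ : 0 < c₁₂) (h₁₃ : 0 < c₁₃) (h₂₃ : 0 < c₂₃),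
    IsGeodesic (wallachMetric n₁ n₂ n₃ c₁₂ c₁₃ c₂₃ h₁₂ h₁₃ h₂₃) (orbitCurve X)

/-- The component `∑_{k ∈ I_r, l ∈ I_s} a_{kl} ξ_{kl}`. -/
def component {n₁ n₂ n₃ : ℕ} (r s : Fin 3)
    (a : Fin (n₁ + n₂ + n₃) → Fin (n₁ + n₂ + n₃) → ℝ) : Mat n₁ n₂ n₃ :=
  ∑ k ∈ I n₁ n₂ n₃ r, ∑ l ∈ I n₁ n₂ n₃ s, a k l • ξ k l

/-- The left-hand side
`∑_{i ∈ I_r, j ∈ I_s} ∑_{k ∈ I_t, l ∈ I_u} a_{ij} a_{kl} B([ξ_{ij}, ξ_{pq}]_𝔪, ξ_{kl})`. -/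
def pairing {n₁ n₂ n₃ : ℕ} (r s t u : Fin 3)
    (a : Fin (n₁ + n₂ + n₃) → Fin (n₁ + n₂ + n₃) → ℝ) (p q : Fin (n₁ + n₂ + n₃)) : ℝ :=
  ∑ i ∈ I n₁ n₂ n₃ r, ∑ j ∈ I n₁ n₂ n₃ s, ∑ k ∈ I n₁ n₂ n₃ t, ∑ l ∈ I n₁ n₂ n₃ u,
    a i j * a k l * B (projM n₁ n₂ n₃ ⁅ξ i j, ξ p q⁆ : Mat n₁ n₂ n₃) (ξ k l)

end GenWallach

end

open GenWallach

/-! For an invariant metric `Λ`, the first variation of the energy along `exp(tX)·o` is a boundary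
term plus the integral of `B([ΛX, X], W)`, where `W` is the variation field moved to the identity
(`hasDerivAt_energy`). With fixed end points `W` ends in block diagonal matrices, which are
`B`-orthogonal to `ΛX`, so `[ΛX, X] = 0` makes the curve a geodesic. Conversely, when `[ΛX, X]` lies
in `𝔪`, varying in its own direction forces it to vanish.

For diagonal `Λ` the bracket has zero diagonal blocks. Its `(r, s)` block equals `(λ_rt - λ_ts)`
times that of `X²`, with `t` the third block (`exists_lie_diagOp_apply_eq`). Hence `X` is geodesic
for the whole family iff `X²` is block diagonal, and one metric with distinct weights already
detects this. The left-hand sides of the system are `-2` times the off-diagonal entries of `X²`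
(`pairing_eq_mul_apply`), which proves the first claim.

For the second claim, every invariant metric is diagonal under the size conditions
(`exists_eq_wallachMetric`). Quarter turns in coordinate planes inside a block lie in `H` and
permute the basis `ξ_kl` up to sign, so equivariance gives sign relations that kill all off-diagonal
coefficients of `Λ` and equate the diagonal ones on each `𝔪_ij`. -/

noncomputable section

namespace GenWallach

/-! ### The form `B`, the projection onto `𝔪` and the adjoint action -/

section Algebra

variable {n₁ n₂ n₃ : ℕ}

theorem B_comm (X Y : Mat n₁ n₂ n₃) : B X Y = B Y X := by
  rw [B, B, Matrix.trace_mul_comm]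

theorem B_lie (X Y Z : Mat n₁ n₂ n₃) : B X ⁅Y, Z⁆ = B ⁅X, Y⁆ Z := by
  simp only [B, Ring.lie_def, Matrix.mul_sub, Matrix.sub_mul, Matrix.trace_sub]
  rw [← Matrix.mul_assoc X Z Y, Matrix.trace_mul_comm (X * Z) Y, Matrix.mul_assoc Y X Z,
    ← Matrix.mul_assoc X Y Z]

/-- `B` as a bilinear map. -/
def bilin (n₁ n₂ n₃ : ℕ) : Mat n₁ n₂ n₃ →ₗ[ℝ] Mat n₁ n₂ n₃ →ₗ[ℝ] ℝ :=
  LinearMap.mk₂ ℝ B (fun X Y Z => by simp [B, Matrix.add_mul]; ring)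
    (fun c X Y => by simp [B]) (fun X Y Z => by simp [B, Matrix.mul_add]; ring)
    (fun c X Y => by simp [B])

theorem bilin_apply (X Y : Mat n₁ n₂ n₃) : bilin n₁ n₂ n₃ X Y = B X Y := rfl

theorem skew_apply (X : 𝔪 n₁ n₂ n₃) (k l : Fin (n₁ + n₂ + n₃)) :
    (X : Mat n₁ n₂ n₃) l k = -(X : Mat n₁ n₂ n₃) k l :=
  congrFun (congrFun X.2.1 k) l

theorem B_ξ (p q : Fin (n₁ + n₂ + n₃)) (Z : Mat n₁ n₂ n₃) : B (ξ p q) Z = Z p q - Z q p := by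
  simp [B, ξ, Matrix.sub_mul, Matrix.trace_sub, Matrix.trace_single_mul]

/-- A skew `Y` with zero diagonal blocks does not see the symmetric part or the diagonal blocks of
`Z`. Projections can therefore be dropped opposite an element of `𝔪`. -/
theorem B_projM (Y : 𝔪 n₁ n₂ n₃) (Z : Mat n₁ n₂ n₃) :
    B (Y : Mat n₁ n₂ n₃) (projM n₁ n₂ n₃ Z) = B (Y : Mat n₁ n₂ n₃) Z := by
  have h : B (Y : Mat n₁ n₂ n₃) (projM n₁ n₂ n₃ Z) =
      (B (Y : Mat n₁ n₂ n₃) Z + B (Y : Mat n₁ n₂ n₃) (-Zᵀ)) / 2 := by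
    simp only [B_apply, projM, LinearMap.coe_mk, AddHom.coe_mk, Matrix.of_apply,
      Matrix.neg_apply, Matrix.transpose_apply]
    rw [← neg_add, neg_div, ← Finset.sum_add_distrib, Finset.sum_div]
    refine congrArg _ (Finset.sum_congr rfl fun k _ => ?_)
    rw [← Finset.sum_add_distrib, Finset.sum_div]
    refine Finset.sum_congr rfl fun l _ => ?_
    split_ifs with h
    · rw [Y.2.2 k l h.symm]; ring
    · ring
  have h' : B (Y : Mat n₁ n₂ n₃) (-Zᵀ) = B (Y : Mat n₁ n₂ n₃) Z := by
    have e := Matrix.trace_transpose ((Y : Mat n₁ n₂ n₃) * Z)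
    rw [Matrix.transpose_mul, Y.2.1, Matrix.mul_neg, Matrix.trace_neg] at e
    rw [B, B, Matrix.mul_neg, Matrix.trace_neg, Matrix.trace_mul_comm, e]
  rw [h, h']; ring

theorem projM_coe (Y : 𝔪 n₁ n₂ n₃) : projM n₁ n₂ n₃ (Y : Mat n₁ n₂ n₃) = Y := by
  ext k l
  simp only [projM, LinearMap.coe_mk, AddHom.coe_mk, Matrix.of_apply]
  split_ifs with h
  · exact (Y.2.2 k l h).symm
  · rw [skew_apply Y k l]; ring

theorem IsBlockDiag.projM_eq_zero {Z : Mat n₁ n₂ n₃} (hZ : IsBlockDiag Z) :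
    projM n₁ n₂ n₃ Z = 0 := by
  ext k l
  simp only [projM, LinearMap.coe_mk, AddHom.coe_mk, Matrix.of_apply]
  split_ifs with h
  · rfl
  · rw [hZ k l h, hZ l k (Ne.symm h)]; simp

theorem B_isBlockDiag (Y : 𝔪 n₁ n₂ n₃) {Z : Mat n₁ n₂ n₃} (hZ : IsBlockDiag Z) :
    B (Y : Mat n₁ n₂ n₃) Z = 0 := by
  rw [← B_projM, hZ.projM_eq_zero]; simp [B]

theorem B_self (Z : Mat n₁ n₂ n₃) (hZ : Zᵀ = -Z) : B Z Z = ∑ k, ∑ l, Z k l ^ 2 := by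
  simp only [B_apply, ← Finset.sum_neg_distrib]
  refine Finset.sum_congr rfl fun k _ => Finset.sum_congr rfl fun l _ => ?_
  have : Z l k = -Z k l := congrFun (congrFun hZ k) l
  rw [this]; ring

theorem eq_zero_of_B_self {Z : Mat n₁ n₂ n₃} (hZ : Zᵀ = -Z) (h : B Z Z = 0) : Z = 0 := by
  rw [B_self Z hZ] at h
  ext k l
  have h1 := (Finset.sum_eq_zero_iff_of_nonneg fun k _ =>
    Finset.sum_nonneg fun l _ => sq_nonneg (Z k l)).1 h k (Finset.mem_univ k)
  have h2 := (Finset.sum_eq_zero_iff_of_nonneg fun l _ => sq_nonneg (Z k l)).1 h1 l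
    (Finset.mem_univ l)
  simpa using h2

theorem B_conj (g : G n₁ n₂ n₃) (X Y : Mat n₁ n₂ n₃) :
    B ((g : Mat n₁ n₂ n₃) * X * (g : Mat n₁ n₂ n₃)ᵀ)
      ((g : Mat n₁ n₂ n₃) * Y * (g : Mat n₁ n₂ n₃)ᵀ) = B X Y := by
  have e : ((g : Mat n₁ n₂ n₃) * X * (g : Mat n₁ n₂ n₃)ᵀ) *
      ((g : Mat n₁ n₂ n₃) * Y * (g : Mat n₁ n₂ n₃)ᵀ) =
      (g : Mat n₁ n₂ n₃) * (X * Y) * (g : Mat n₁ n₂ n₃)ᵀ := by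
    simp only [Matrix.mul_assoc]
    rw [← Matrix.mul_assoc (g : Mat n₁ n₂ n₃)ᵀ (g : Mat n₁ n₂ n₃), transpose_mul_self,
      Matrix.one_mul]
  rw [B, B, e, Matrix.trace_mul_comm, ← Matrix.mul_assoc, transpose_mul_self, Matrix.one_mul]

theorem Ad_coe (h : H n₁ n₂ n₃) (X : 𝔪 n₁ n₂ n₃) :
    (Ad h X : Mat n₁ n₂ n₃) = (h.1 : Mat n₁ n₂ n₃) * X * (h.1 : Mat n₁ n₂ n₃)ᵀ := rfl

theorem B_Ad (h : H n₁ n₂ n₃) (X Y : 𝔪 n₁ n₂ n₃) :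
    B (Ad h X : Mat n₁ n₂ n₃) (Ad h Y) = B (X : Mat n₁ n₂ n₃) Y :=
  B_conj h.1 X Y

/-- Two elements of `𝔪` with the same pairings against `𝔪` agree. -/
theorem eq_of_B_eq {X Y : 𝔪 n₁ n₂ n₃}
    (h : ∀ Z : 𝔪 n₁ n₂ n₃, B (X : Mat n₁ n₂ n₃) Z = B (Y : Mat n₁ n₂ n₃) Z) : X = Y := by
  rw [← sub_eq_zero]
  refine Subtype.ext (eq_zero_of_B_self (X - Y).2.1 ?_)
  have := h (X - Y)
  rw [← bilin_apply, ← bilin_apply, ← sub_eq_zero, ← LinearMap.sub_apply, ← map_sub] at this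
  exact this

/-- Conjugation by `h` is a `B`-isometry that maps `𝔪` onto itself, so both sides have the same
pairings with `𝔪`. -/
theorem Ad_projM (h : H n₁ n₂ n₃) (Z : Mat n₁ n₂ n₃) :
    Ad h (projM n₁ n₂ n₃ Z) =
      projM n₁ n₂ n₃ ((h.1 : Mat n₁ n₂ n₃) * Z * (h.1 : Mat n₁ n₂ n₃)ᵀ) := by
  have hc : ∀ Y : 𝔪 n₁ n₂ n₃, Ad h (Ad h⁻¹ Y) = Y := fun Y => by
    refine Subtype.ext ?_
    rw [Ad_coe, Ad_coe]
    have e : ((h⁻¹ : H n₁ n₂ n₃).1 : Mat n₁ n₂ n₃) = (h.1 : Mat n₁ n₂ n₃)ᵀ := rfl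
    rw [e, Matrix.transpose_transpose, Matrix.mul_assoc, Matrix.mul_assoc, Matrix.mul_assoc,
      mul_transpose_self, Matrix.mul_one, ← Matrix.mul_assoc, mul_transpose_self, Matrix.one_mul]
  refine eq_of_B_eq fun Y => ?_
  rw [← hc Y, B_Ad, B_comm, B_projM, B_comm _ (Ad h (Ad h⁻¹ Y) : Mat n₁ n₂ n₃), B_projM, Ad_coe h,
    B_conj]

/-! ### The system (A), (B), (C) in terms of `X²` -/

theorem block_cases (k : Fin (n₁ + n₂ + n₃)) :
    block n₁ n₂ n₃ k = 0 ∨ block n₁ n₂ n₃ k = 1 ∨ block n₁ n₂ n₃ k = 2 := by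
  unfold block; split_ifs <;> simp

theorem mem_I {r : Fin 3} {k : Fin (n₁ + n₂ + n₃)} :
    k ∈ I n₁ n₂ n₃ r ↔ block n₁ n₂ n₃ k = r := by
  simp [I]

theorem component_apply (r s : Fin 3) (a : Fin (n₁ + n₂ + n₃) → Fin (n₁ + n₂ + n₃) → ℝ)
    (p q : Fin (n₁ + n₂ + n₃)) :
    component r s a p q =
      (if block n₁ n₂ n₃ p = r ∧ block n₁ n₂ n₃ q = s then a p q else 0) -
      (if block n₁ n₂ n₃ q = r ∧ block n₁ n₂ n₃ p = s then a q p else 0) := by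
  have key : ∀ p q : Fin (n₁ + n₂ + n₃),
      ∑ k ∈ I n₁ n₂ n₃ r, ∑ l ∈ I n₁ n₂ n₃ s, (a k l * Matrix.single k l (1 : ℝ) p q) =
      if block n₁ n₂ n₃ p = r ∧ block n₁ n₂ n₃ q = s then a p q else 0 := fun p q => by
    have : ∀ k l : Fin (n₁ + n₂ + n₃), a k l * Matrix.single k l (1 : ℝ) p q =
        if p = k then (if q = l then a k l else 0) else 0 := fun k l => by
      simp only [Matrix.single_apply, ite_and, eq_comm (a := k), eq_comm (a := l)]
      split_ifs <;> simp
    simp only [this, Finset.sum_ite_irrel, Finset.sum_const_zero, Finset.sum_ite_eq, mem_I]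
    split_ifs <;> simp_all
  have hs : ∀ k l : Fin (n₁ + n₂ + n₃),
      Matrix.single l k (1 : ℝ) p q = Matrix.single k l (1 : ℝ) q p := fun k l => by
    simp only [Matrix.single_apply, and_comm]
  simp only [component, ξ, Matrix.sum_apply, Matrix.smul_apply, Matrix.sub_apply, smul_eq_mul,
    mul_sub, Finset.sum_sub_distrib]
  rw [← key p q, ← key q p]
  simp only [hs]

theorem component_mem {r s : Fin 3} (hrs : r ≠ s)
    (a : Fin (n₁ + n₂ + n₃) → Fin (n₁ + n₂ + n₃) → ℝ) :
    (component r s a : Mat n₁ n₂ n₃) ∈ 𝔪 n₁ n₂ n₃ := by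
  refine ⟨?_, fun k l h => ?_⟩
  · ext k l
    simp only [Matrix.transpose_apply, Matrix.neg_apply, component_apply]
    ring
  · rw [component_apply, h, if_neg (fun e => hrs (e.1.symm.trans e.2)),
      if_neg (fun e => hrs (e.1.symm.trans e.2)), sub_zero]

/-- Bilinearity collapses the quadruple sum, and the invariance of `B` moves the bracket onto the
two components. The projection is harmless because `component t u a` lies in `𝔪`. -/
theorem pairing_eq_B (r s t u : Fin 3) (htu : t ≠ u)
    (a : Fin (n₁ + n₂ + n₃) → Fin (n₁ + n₂ + n₃) → ℝ) (p q : Fin (n₁ + n₂ + n₃)) :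
    pairing r s t u a p q = B (ξ p q) ⁅component t u a, component r s a⁆ := by
  have e : B (ξ p q) ⁅component t u a, component r s a⁆ =
      B (component t u a) ⁅component r s a, ξ p q⁆ := by
    rw [B_comm, ← B_lie]
  have f : B (projM n₁ n₂ n₃ ⁅component r s a, ξ p q⁆ : Mat n₁ n₂ n₃) (component t u a) =
      B (component t u a) ⁅component r s a, ξ p q⁆ := by
    rw [B_comm]; exact B_projM ⟨_, component_mem htu a⟩ _
  rw [e, ← f]
  have g : ∀ Y : Mat n₁ n₂ n₃, B Y (component t u a) =
      ∑ k ∈ I n₁ n₂ n₃ t, ∑ l ∈ I n₁ n₂ n₃ u, a k l * B Y (ξ k l) := fun Y => by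
    rw [← bilin_apply, component]
    simp only [map_sum, map_smul, smul_eq_mul, bilin_apply]
  have g' : ∀ Y : Mat n₁ n₂ n₃,
      B (projM n₁ n₂ n₃ ⁅component r s a, ξ p q⁆ : Mat n₁ n₂ n₃) Y =
      ∑ i ∈ I n₁ n₂ n₃ r, ∑ j ∈ I n₁ n₂ n₃ s,
        a i j * B (projM n₁ n₂ n₃ ⁅ξ i j, ξ p q⁆ : Mat n₁ n₂ n₃) Y := fun Y => by
    rw [← bilin_apply, component]
    simp only [Ring.lie_def, Finset.sum_mul, Finset.mul_sum, Matrix.smul_mul, Matrix.mul_smul,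
      ← Finset.sum_sub_distrib, ← smul_sub, map_sum, map_smul, smul_eq_mul, bilin_apply,
      Submodule.coe_sum, Submodule.coe_smul, LinearMap.sum_apply, LinearMap.smul_apply]
  rw [g', pairing]
  refine Finset.sum_congr rfl fun i _ => Finset.sum_congr rfl fun j _ => ?_
  rw [g, Finset.mul_sum]
  refine Finset.sum_congr rfl fun k _ => ?_
  rw [Finset.mul_sum]
  refine Finset.sum_congr rfl fun l _ => ?_
  ring

/-- The left-hand sides of the system are `-2` times the off-diagonal entries of `X²`. -/
theorem pairing_eq_mul_apply (r s t u v w : Fin 3)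
    (h : (r, s, t, u, v, w) = (0, 1, 0, 2, 1, 2) ∨ (r, s, t, u, v, w) = (0, 1, 1, 2, 0, 2) ∨
      (r, s, t, u, v, w) = (0, 2, 1, 2, 0, 1))
    (a : Fin (n₁ + n₂ + n₃) → Fin (n₁ + n₂ + n₃) → ℝ) (X : Mat n₁ n₂ n₃)
    (hX : X = component 0 1 a + component 0 2 a + component 1 2 a)
    {p q : Fin (n₁ + n₂ + n₃)} (hp : block n₁ n₂ n₃ p = v) (hq : block n₁ n₂ n₃ q = w) :
    pairing r s t u a p q = -2 * (X * X) p q := by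
  have htu : t ≠ u := by
    rcases h with h | h | h <;> simp only [Prod.mk.injEq] at h <;>
      obtain ⟨rfl, rfl, rfl, rfl, rfl, rfl⟩ := h <;> decide
  rw [pairing_eq_B r s t u htu, B_ξ, Ring.lie_def, Matrix.sub_apply, Matrix.sub_apply]
  simp only [Matrix.mul_apply, ← Finset.sum_sub_distrib, Finset.mul_sum]
  -- The identity holds term by term: only `j` in the block different from those of `p` and `q`
  -- contributes. The factor 2 comes from the skewness of the bracket.
  refine Finset.sum_congr rfl fun j _ => ?_
  rcases h with h | h | h <;> simp only [Prod.mk.injEq] at h <;>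
    obtain ⟨rfl, rfl, rfl, rfl, rfl, rfl⟩ := h <;>
    rcases block_cases j with hj | hj | hj <;>
    simp [hX, component_apply, hp, hq, hj] <;> ring

/-- The system holds exactly when the off-diagonal blocks of `X²` vanish. -/
theorem system_iff_sq_isBlockDiag (a : Fin (n₁ + n₂ + n₃) → Fin (n₁ + n₂ + n₃) → ℝ)
    (X : 𝔪 n₁ n₂ n₃)
    (hX : (X : Mat n₁ n₂ n₃) = component 0 1 a + component 0 2 a + component 1 2 a) :
    ((∀ p ∈ I n₁ n₂ n₃ 1, ∀ q ∈ I n₁ n₂ n₃ 2, pairing 0 1 0 2 a p q = 0) ∧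
      (∀ p ∈ I n₁ n₂ n₃ 0, ∀ q ∈ I n₁ n₂ n₃ 2, pairing 0 1 1 2 a p q = 0) ∧
      (∀ p ∈ I n₁ n₂ n₃ 0, ∀ q ∈ I n₁ n₂ n₃ 1, pairing 0 2 1 2 a p q = 0)) ↔
    IsBlockDiag ((X : Mat n₁ n₂ n₃) * (X : Mat n₁ n₂ n₃)) := by
  -- The square of a skew matrix is symmetric, so the three blocks above the diagonal suffice.
  have symm : ∀ p q, ((X : Mat n₁ n₂ n₃) * (X : Mat n₁ n₂ n₃)) p q =
      ((X : Mat n₁ n₂ n₃) * (X : Mat n₁ n₂ n₃)) q p := fun p q => by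
    simp only [Matrix.mul_apply]
    refine Finset.sum_congr rfl fun j _ => ?_
    rw [skew_apply X j p, skew_apply X q j]; ring
  have hA := fun p q => pairing_eq_mul_apply (p := p) (q := q) 0 1 0 2 1 2 (by simp) a _ hX
  have hB := fun p q => pairing_eq_mul_apply (p := p) (q := q) 0 1 1 2 0 2 (by simp) a _ hX
  have hC := fun p q => pairing_eq_mul_apply (p := p) (q := q) 0 2 1 2 0 1 (by simp) a _ hX
  simp only [mem_I]
  constructor
  · rintro ⟨A, B, C⟩ p q hpq
    rcases block_cases p with hp | hp | hp <;> rcases block_cases q with hq | hq | hq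
    · exact absurd (hp.trans hq.symm) hpq
    · linarith [C p hp q hq, hC p q hp hq]
    · linarith [B p hp q hq, hB p q hp hq]
    · rw [symm]; linarith [C q hq p hp, hC q p hq hp]
    · exact absurd (hp.trans hq.symm) hpq
    · linarith [A p hp q hq, hA p q hp hq]
    · rw [symm]; linarith [B q hq p hp, hB q p hq hp]
    · rw [symm]; linarith [A q hq p hp, hA q p hq hp]
    · exact absurd (hp.trans hq.symm) hpq
  · intro h
    refine ⟨fun p hp q hq => ?_, fun p hp q hq => ?_, fun p hp q hq => ?_⟩
    · rw [hA p q hp hq, h p q (by rw [hp, hq]; decide), mul_zero]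
    · rw [hB p q hp hq, h p q (by rw [hp, hq]; decide), mul_zero]
    · rw [hC p q hp hq, h p q (by rw [hp, hq]; decide), mul_zero]

/-! ### The bracket `[ΛX, X]` for diagonal `Λ` -/

theorem lie_diagOp_apply (c₁₂ c₁₃ c₂₃ : ℝ) (X : 𝔪 n₁ n₂ n₃) (k l : Fin (n₁ + n₂ + n₃)) :
    ⁅(diagOp n₁ n₂ n₃ c₁₂ c₁₃ c₂₃ X : Mat n₁ n₂ n₃), (X : Mat n₁ n₂ n₃)⁆ k l =
      ∑ j, (pairWeight c₁₂ c₁₃ c₂₃ (block n₁ n₂ n₃ k) (block n₁ n₂ n₃ j) -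
        pairWeight c₁₂ c₁₃ c₂₃ (block n₁ n₂ n₃ j) (block n₁ n₂ n₃ l)) *
        ((X : Mat n₁ n₂ n₃) k j * (X : Mat n₁ n₂ n₃) j l) := by
  simp only [Ring.lie_def, Matrix.sub_apply, Matrix.mul_apply, ← Finset.sum_sub_distrib, diagOp,
    LinearMap.coe_mk, AddHom.coe_mk, Matrix.of_apply]
  exact Finset.sum_congr rfl fun j _ => by ring

theorem lie_diagOp_apply_of_block_eq (c₁₂ c₁₃ c₂₃ : ℝ) (X : 𝔪 n₁ n₂ n₃)
    {k l : Fin (n₁ + n₂ + n₃)} (h : block n₁ n₂ n₃ k = block n₁ n₂ n₃ l) :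
    ⁅(diagOp n₁ n₂ n₃ c₁₂ c₁₃ c₂₃ X : Mat n₁ n₂ n₃), (X : Mat n₁ n₂ n₃)⁆ k l = 0 := by
  rw [lie_diagOp_apply]
  refine Finset.sum_eq_zero fun j _ => ?_
  rw [h, pairWeight_comm]; ring

/-- Between two different blocks, `[ΛX, X]` is a multiple of `X²`, for diagonal `Λ`. -/
theorem exists_lie_diagOp_apply_eq (c₁₂ c₁₃ c₂₃ : ℝ) {r s : Fin 3} (hrs : r ≠ s) :
    ∃ c : ℝ, (c₁₂ = 1 → c₁₃ = 2 → c₂₃ = 3 → c ≠ 0) ∧ ∀ (X : 𝔪 n₁ n₂ n₃)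
      (k l : Fin (n₁ + n₂ + n₃)), block n₁ n₂ n₃ k = r → block n₁ n₂ n₃ l = s →
      ⁅(diagOp n₁ n₂ n₃ c₁₂ c₁₃ c₂₃ X : Mat n₁ n₂ n₃), (X : Mat n₁ n₂ n₃)⁆ k l =
        c * ((X : Mat n₁ n₂ n₃) * (X : Mat n₁ n₂ n₃)) k l := by
  -- With three blocks, `X k j * X j l` can be nonzero only for `j` in the remaining block `t`, so a
  -- single difference of weights factors out.
  obtain ⟨t, hr, hs, ht⟩ : ∃ t : Fin 3, t ≠ r ∧ t ≠ s ∧ ∀ j : Fin 3, j = r ∨ j = s ∨ j = t := by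
    revert r s; decide
  refine ⟨pairWeight c₁₂ c₁₃ c₂₃ r t - pairWeight c₁₂ c₁₃ c₂₃ t s, ?_, ?_⟩
  · rintro rfl rfl rfl
    fin_cases r <;> fin_cases s <;> fin_cases t <;> simp_all [pairWeight] <;> norm_num
  · intro X k l hk hl
    rw [lie_diagOp_apply, Matrix.mul_apply, Finset.mul_sum]
    refine Finset.sum_congr rfl fun j _ => ?_
    rcases ht (block n₁ n₂ n₃ j) with h | h | h
    · rw [X.2.2 k j (hk.trans h.symm)]; ring
    · rw [X.2.2 j l (h.trans hl.symm)]; ring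
    · rw [hk, hl, h]

theorem lie_diagOp_eq_zero {X : 𝔪 n₁ n₂ n₃}
    (hX : IsBlockDiag ((X : Mat n₁ n₂ n₃) * (X : Mat n₁ n₂ n₃))) (c₁₂ c₁₃ c₂₃ : ℝ) :
    ⁅(diagOp n₁ n₂ n₃ c₁₂ c₁₃ c₂₃ X : Mat n₁ n₂ n₃), (X : Mat n₁ n₂ n₃)⁆ = 0 := by
  ext k l
  by_cases h : block n₁ n₂ n₃ k = block n₁ n₂ n₃ l
  · exact lie_diagOp_apply_of_block_eq c₁₂ c₁₃ c₂₃ X h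
  · obtain ⟨c, -, hc⟩ := exists_lie_diagOp_apply_eq (n₁ := n₁) (n₂ := n₂) (n₃ := n₃) c₁₂ c₁₃ c₂₃ h
    rw [hc X k l rfl rfl, hX k l h, mul_zero]; rfl

theorem isBlockDiag_sq_of_lie_diagOp_eq_zero {X : 𝔪 n₁ n₂ n₃}
    (h : ⁅(diagOp n₁ n₂ n₃ 1 2 3 X : Mat n₁ n₂ n₃), (X : Mat n₁ n₂ n₃)⁆ = 0) :
    IsBlockDiag ((X : Mat n₁ n₂ n₃) * (X : Mat n₁ n₂ n₃)) := by
  intro k l hkl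
  obtain ⟨c, hc0, hc⟩ := exists_lie_diagOp_apply_eq (n₁ := n₁) (n₂ := n₂) (n₃ := n₃) 1 2 3 hkl
  have := hc X k l rfl rfl
  rw [h] at this
  exact (mul_eq_zero.1 this.symm).resolve_left (hc0 rfl rfl rfl)

/-- A bracket of skew matrices is skew, so only the diagonal blocks need checking. This makes the
bracket itself available as a direction of variation. -/
theorem lie_mem {Y X : 𝔪 n₁ n₂ n₃}
    (h : ∀ k l, block n₁ n₂ n₃ k = block n₁ n₂ n₃ l →
      ⁅(Y : Mat n₁ n₂ n₃), (X : Mat n₁ n₂ n₃)⁆ k l = 0) :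
    ⁅(Y : Mat n₁ n₂ n₃), (X : Mat n₁ n₂ n₃)⁆ ∈ 𝔪 n₁ n₂ n₃ := by
  refine ⟨?_, h⟩
  rw [Ring.lie_def, Matrix.transpose_sub, Matrix.transpose_mul, Matrix.transpose_mul, X.2.1, Y.2.1]
  simp

/-! ### Quarter turns in `H` and their action on the basis of `𝔪` -/

/-- The square of an orthogonal block diagonal matrix lies in `H`. -/
theorem exists_H_coe_eq_mul_self {Q : Mat n₁ n₂ n₃} (hb : IsBlockDiag Q) (hQ : Q * Qᵀ = 1) :
    ∃ h : H n₁ n₂ n₃, (h.1 : Mat n₁ n₂ n₃) = Q * Q := by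
  -- `det (A * A) = det (A * Aᵀ) = 1`: a square has the right determinant in every block, with no
  -- determinant to compute.
  have orth : ∀ {ι : Type} [Fintype ι] [DecidableEq ι] (A : Matrix ι ι ℝ), A * Aᵀ = 1 →
      A * A ∈ Matrix.specialOrthogonalGroup ι ℝ := by
    intro ι _ _ A hA
    refine Matrix.mem_specialOrthogonalGroup_iff.2 ⟨?_, ?_⟩
    · have := (Matrix.mem_orthogonalGroup_iff ι ℝ).2 hA
      exact mul_mem this this
    · have hd := congrArg Matrix.det hA
      rwa [Matrix.det_mul, Matrix.det_transpose, Matrix.det_one, ← Matrix.det_mul] at hd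
  refine ⟨⟨⟨Q * Q, orth Q hQ⟩, hb.mul hb, fun r => ?_⟩, rfl⟩
  change (Q * Q).toSquareBlock _ r ∈ _
  rw [hb.toSquareBlock_mul]
  refine orth _ ?_
  have e := hb.toSquareBlock_mul Qᵀ r
  rw [hQ] at e
  refine Eq.trans e.symm ?_
  ext k l
  change (1 : Mat n₁ n₂ n₃) k.1 l.1 = _
  simp [Matrix.one_apply, Subtype.ext_iff]

/-- The sign in the action of a quarter turn on basis vectors. -/
def turnSign (y k : Fin (n₁ + n₂ + n₃)) : ℝ := if k = y then -1 else 1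

/-- The quarter turn `e_x ↦ e_y`, `e_y ↦ -e_x` in a coordinate plane inside a block. -/
theorem exists_quarter_turn {x y : Fin (n₁ + n₂ + n₃)} (hxy : x ≠ y)
    (hb : block n₁ n₂ n₃ x = block n₁ n₂ n₃ y) :
    ∃ h : H n₁ n₂ n₃, ∀ u v, (h.1 : Mat n₁ n₂ n₃) u v =
      if u = Equiv.swap x y v then turnSign y v else 0 := by
  set P : Mat n₁ n₂ n₃ := Matrix.single x x 1 + Matrix.single y y 1 with hP
  set J : Mat n₁ n₂ n₃ := Matrix.single y x 1 - Matrix.single x y 1 with hJ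
  have hPP : P * P = P := by
    simp [hP, Matrix.add_mul, Matrix.mul_add, Matrix.single_mul_single_of_ne, hxy, hxy.symm]
  have hPJ : P * J = J := by
    simp [hP, hJ, Matrix.add_mul, Matrix.mul_sub, Matrix.single_mul_single_of_ne, hxy, hxy.symm]
  have hJP : J * P = J := by
    simp [hP, hJ, Matrix.sub_mul, Matrix.mul_add, Matrix.single_mul_single_of_ne, hxy, hxy.symm]
    rw [← sub_eq_add_neg]
  have hJJ : J * J = -P := by
    simp [hP, hJ, Matrix.sub_mul, Matrix.mul_sub, Matrix.single_mul_single_of_ne, hxy, hxy.symm]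
    abel
  have hPt : Pᵀ = P := by simp [hP]
  have hJt : Jᵀ = -J := by simp [hJ]
  obtain ⟨c, hcc⟩ : ∃ c : ℝ, c * c = 1 / 2 :=
    ⟨Real.sqrt (1 / 2), Real.mul_self_sqrt (by norm_num)⟩
  -- An eighth turn: `P` projects onto the plane of `e_x`, `e_y`, and `J² = -P`. On that plane `Q² =
  -- c²(1 + J)² = 2c²J = J`, the quarter turn; the sign of `c` is immaterial.
  set Q : Mat n₁ n₂ n₃ := 1 + (c - 1) • P + c • J with hQ
  have hQb : IsBlockDiag Q := by
    intro k l hkl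
    have h0 : k ≠ l := fun e => hkl (by rw [e])
    have h1 : ∀ (u v : Fin (n₁ + n₂ + n₃)) (t : ℝ), block n₁ n₂ n₃ u = block n₁ n₂ n₃ v →
        Matrix.single u v t k l = 0 := fun u v t huv =>
      Matrix.single_apply_of_ne _ _ _ _ _ (by rintro ⟨rfl, rfl⟩; exact hkl huv)
    simp [hQ, hP, hJ, h1 _ _ _ rfl, h1 _ _ _ hb, h1 _ _ _ hb.symm, h0]
  have hQt : Q * Qᵀ = 1 := by
    rw [hQ, Matrix.transpose_add, Matrix.transpose_add, Matrix.transpose_smul,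
      Matrix.transpose_smul, hPt, hJt, Matrix.transpose_one]
    simp only [Matrix.add_mul, Matrix.mul_add, Matrix.smul_mul, Matrix.mul_smul, Matrix.mul_neg,
      Matrix.one_mul, Matrix.mul_one, smul_neg, hPP, hPJ, hJP, hJJ]
    match_scalars <;> first | ring1 | linear_combination 2 * hcc
  have hQQ : Q * Q = 1 - P + J := by
    rw [hQ]
    simp only [Matrix.add_mul, Matrix.mul_add, Matrix.smul_mul, Matrix.mul_smul,
      Matrix.one_mul, Matrix.mul_one, smul_neg, hPP, hPJ, hJP, hJJ]
    match_scalars <;> first | ring1 | linear_combination 2 * hcc | linear_combination (-2) * hcc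
  obtain ⟨h, hh⟩ := exists_H_coe_eq_mul_self hQb hQt
  refine ⟨h, fun u v => ?_⟩
  rw [hh, hQQ]
  simp only [hP, hJ, Matrix.add_apply, Matrix.sub_apply, Matrix.one_apply, Matrix.single_apply,
    turnSign, Equiv.swap_apply_def]
  by_cases hvx : v = x
  · subst hvx
    by_cases huv : u = v
    · subst huv; simp [hxy, hxy.symm]
    · by_cases huy : u = y
      · subst huy; simp [hxy, hxy.symm]
      · simp [huv, huy, Ne.symm huv, Ne.symm huy, hxy.symm]
  · by_cases hvy : v = y
    · subst hvy
      by_cases hux : u = x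
      · subst hux; simp [hxy, hxy.symm]
      · by_cases huv : u = v
        · subst huv; simp [hxy, hxy.symm]
        · simp [huv, hux, Ne.symm huv, Ne.symm hux, hxy, hxy.symm]
    · simp [hvx, hvy, Ne.symm hvx, Ne.symm hvy]

/-- The element `(ξ k l)_𝔪` of `𝔪`. -/
def η (k l : Fin (n₁ + n₂ + n₃)) : 𝔪 n₁ n₂ n₃ := projM n₁ n₂ n₃ (ξ k l)

theorem η_swap (k l : Fin (n₁ + n₂ + n₃)) : η (n₁ := n₁) l k = -η k l := by
  rw [η, η, ← map_neg]
  congr 1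
  simp [ξ]

theorem B_η (k l : Fin (n₁ + n₂ + n₃)) (Y : 𝔪 n₁ n₂ n₃) :
    B (Y : Mat n₁ n₂ n₃) (η k l) = 2 * (Y : Mat n₁ n₂ n₃) k l := by
  rw [η, B_projM, B_comm, B_ξ, skew_apply Y k l]; ring

/-- A quarter turn is a signed permutation matrix, so conjugation sends matrix units to signed
matrix units. -/
theorem Ad_η_of_turn {h : H n₁ n₂ n₃} {x y : Fin (n₁ + n₂ + n₃)}
    (hh : ∀ u v, (h.1 : Mat n₁ n₂ n₃) u v = if u = Equiv.swap x y v then turnSign y v else 0)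
    (k l : Fin (n₁ + n₂ + n₃)) :
    Ad h (η k l) = (turnSign y k * turnSign y l) • η (Equiv.swap x y k) (Equiv.swap x y l) := by
  rw [η, η, Ad_projM, ← map_smul]
  congr 1
  ext u v
  have key : ∀ k l, ((h.1 : Mat n₁ n₂ n₃) * Matrix.single k l 1 * (h.1 : Mat n₁ n₂ n₃)ᵀ :
      Mat n₁ n₂ n₃) u v = turnSign y k * turnSign y l *
        Matrix.single (Equiv.swap x y k) (Equiv.swap x y l) (1 : ℝ) u v := fun k l => by
    rw [conj_apply, Finset.sum_eq_single l, Finset.sum_eq_single k]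
    · rw [hh, hh, Matrix.single_apply_same, Matrix.single_apply]
      simp only [eq_comm (a := Equiv.swap x y k), eq_comm (a := Equiv.swap x y l)]
      by_cases h1 : u = Equiv.swap x y k <;> by_cases h2 : v = Equiv.swap x y l <;> simp [h1, h2]
    · intro i _ hi
      rw [Matrix.single_apply_of_row_ne (Ne.symm hi)]; ring
    · simp
    · intro j _ hj
      refine Finset.sum_eq_zero fun i _ => ?_
      rw [Matrix.single_apply_of_col_ne _ _ (Ne.symm hj)]; ring
    · simp
  rw [ξ, ξ, Matrix.mul_sub, Matrix.sub_mul, Matrix.sub_apply, key, key, Matrix.smul_apply,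
    Matrix.sub_apply, smul_eq_mul]
  ring

/-! ### Relations between the coefficients of an invariant metric -/

/-- The matrix coefficients of an invariant metric. -/
def coeff (M : InvariantMetric n₁ n₂ n₃) (k l p q : Fin (n₁ + n₂ + n₃)) : ℝ :=
  B (M.Λ (η k l) : Mat n₁ n₂ n₃) (η p q)

variable (M : InvariantMetric n₁ n₂ n₃)

theorem coeff_symm (k l p q : Fin (n₁ + n₂ + n₃)) : coeff M k l p q = coeff M p q k l := by
  rw [coeff, M.symm, B_comm, coeff]

theorem coeff_swap_left (k l p q : Fin (n₁ + n₂ + n₃)) : coeff M l k p q = -coeff M k l p q := by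
  rw [coeff, η_swap k l, map_neg, Submodule.coe_neg, ← bilin_apply, map_neg, LinearMap.neg_apply]; rfl

theorem coeff_swap_right (k l p q : Fin (n₁ + n₂ + n₃)) : coeff M k l q p = -coeff M k l p q := by
  rw [coeff, η_swap p q, Submodule.coe_neg, ← bilin_apply, map_neg]; rfl

/-- Equivariance of `Λ` and invariance of `B`, applied to one quarter turn. The vanishing results
below come from choosing the plane. -/
theorem coeff_turn {x y : Fin (n₁ + n₂ + n₃)} (hxy : x ≠ y)
    (hb : block n₁ n₂ n₃ x = block n₁ n₂ n₃ y) (k l p q : Fin (n₁ + n₂ + n₃)) :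
    coeff M k l p q = turnSign y k * turnSign y l * (turnSign y p * turnSign y q) *
      coeff M (Equiv.swap x y k) (Equiv.swap x y l) (Equiv.swap x y p) (Equiv.swap x y q) := by
  obtain ⟨h, hh⟩ := exists_quarter_turn hxy hb
  rw [coeff, ← B_Ad h, M.equivariant, Ad_η_of_turn hh, Ad_η_of_turn hh, map_smul,
    Submodule.coe_smul, Submodule.coe_smul, ← bilin_apply, map_smul, map_smul,
    LinearMap.smul_apply, bilin_apply, smul_eq_mul, smul_eq_mul, coeff]
  ring

/-- Coefficients in which exactly one of two indices `x`, `y` of a block occurs, and once, vanish. -/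
theorem coeff_eq_zero_of_left {x l p q : Fin (n₁ + n₂ + n₃)} (y : Fin (n₁ + n₂ + n₃))
    (hb : block n₁ n₂ n₃ x = block n₁ n₂ n₃ y) (hxy : x ≠ y) (h1 : l ≠ x) (h2 : l ≠ y)
    (h3 : p ≠ x) (h4 : p ≠ y) (h5 : q ≠ x) (h6 : q ≠ y) : coeff M x l p q = 0 := by
  -- One turn replaces `x` by `y`, the next replaces `y` by `-x`: the coefficient equals its own
  -- negative.
  have e1 := coeff_turn M hxy hb x l p q
  have e2 := coeff_turn M hxy hb y l p q
  simp only [Equiv.swap_apply_left, Equiv.swap_apply_right, Equiv.swap_apply_of_ne_of_ne h1 h2,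
    Equiv.swap_apply_of_ne_of_ne h3 h4, Equiv.swap_apply_of_ne_of_ne h5 h6, turnSign, hxy, h2, h4,
    h6, if_true, if_false] at e1 e2
  linarith

/-- The turn in the plane of `l` and `q` exchanges the two arguments with a sign `-1`, against the
symmetry of `Λ`. No third index is needed, so blocks of size 2 are allowed. -/
theorem coeff_eq_zero_of_common {k l q : Fin (n₁ + n₂ + n₃)}
    (hb : block n₁ n₂ n₃ l = block n₁ n₂ n₃ q) (hlq : l ≠ q)
    (hk : block n₁ n₂ n₃ k ≠ block n₁ n₂ n₃ l) : coeff M k l k q = 0 := by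
  have h1 : k ≠ l := fun e => hk (by rw [e])
  have h2 : k ≠ q := fun e => hk (by rw [hb, e])
  have e1 := coeff_turn M hlq hb k l k q
  simp only [Equiv.swap_apply_left, Equiv.swap_apply_right, Equiv.swap_apply_of_ne_of_ne h1 h2,
    turnSign, hlq, h2, if_true, if_false] at e1
  rw [coeff_symm M k q k l] at e1
  linarith

theorem coeff_diag_eq {k k' l : Fin (n₁ + n₂ + n₃)}
    (hb : block n₁ n₂ n₃ k = block n₁ n₂ n₃ k')
    (hl : block n₁ n₂ n₃ k ≠ block n₁ n₂ n₃ l) : coeff M k l k l = coeff M k' l k' l := by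
  by_cases hk : k = k'
  · rw [hk]
  have h1 : l ≠ k := fun e => hl (by rw [e])
  have h2 : l ≠ k' := fun e => hl (by rw [hb, e])
  have e1 := coeff_turn M hk hb k l k l
  simp only [Equiv.swap_apply_left, Equiv.swap_apply_of_ne_of_ne h1 h2, turnSign, hk, h2,
    if_false] at e1
  linarith

/-! ### Block sizes and the diagonality of invariant metrics -/

theorem card_I (r : Fin 3) : (I n₁ n₂ n₃ r).card = ![n₁, n₂, n₃] r := by
  have h0 : I n₁ n₂ n₃ 0 = Finset.univ.image fun i : Fin n₁ => ⟨i, by omega⟩ := by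
    ext k
    simp only [mem_I, block, Finset.mem_image, Finset.mem_univ, true_and, Fin.ext_iff]
    split_ifs with h h' <;> simp
    · exact ⟨⟨k, h⟩, rfl⟩
    · rintro ⟨i, hi⟩ e; simp at e; omega
    · rintro ⟨i, hi⟩ e; simp at e; omega
  have h1 : I n₁ n₂ n₃ 1 = Finset.univ.image fun i : Fin n₂ => ⟨n₁ + i, by omega⟩ := by
    ext k
    simp only [mem_I, block, Finset.mem_image, Finset.mem_univ, true_and, Fin.ext_iff]
    split_ifs with h h' <;> simp
    · rintro ⟨i, hi⟩ e; simp at e; omega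
    · exact ⟨⟨k - n₁, by omega⟩, by simp; omega⟩
    · rintro ⟨i, hi⟩ e; simp at e; omega
  have h2 : I n₁ n₂ n₃ 2 = Finset.univ.image fun i : Fin n₃ => ⟨n₁ + n₂ + i, by omega⟩ := by
    ext k
    simp only [mem_I, block, Finset.mem_image, Finset.mem_univ, true_and, Fin.ext_iff]
    split_ifs with h h' <;> simp
    · rintro ⟨i, hi⟩ e; simp at e; omega
    · rintro ⟨i, hi⟩ e; simp at e; omega
    · exact ⟨⟨k - (n₁ + n₂), by omega⟩, by simp; omega⟩
  fin_cases r
  · change (I n₁ n₂ n₃ 0).card = n₁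
    rw [h0, Finset.card_image_of_injective, Finset.card_univ, Fintype.card_fin]
    intro i j hij; simpa [Fin.ext_iff] using hij
  · change (I n₁ n₂ n₃ 1).card = n₂
    rw [h1, Finset.card_image_of_injective, Finset.card_univ, Fintype.card_fin]
    intro i j hij; simpa [Fin.ext_iff] using hij
  · change (I n₁ n₂ n₃ 2).card = n₃
    rw [h2, Finset.card_image_of_injective, Finset.card_univ, Fintype.card_fin]
    intro i j hij; simpa [Fin.ext_iff] using hij

/-- At most one of the three block sizes equals `m`. -/
def AtMostOneBlock (n₁ n₂ n₃ m : ℕ) : Prop :=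
  ∀ r s : Fin 3, r ≠ s → (I n₁ n₂ n₃ r).card = m → (I n₁ n₂ n₃ s).card ≠ m

theorem atMostOneBlock {m : ℕ} (h₁₂ : ¬ (n₁ = m ∧ n₂ = m)) (h₁₃ : ¬ (n₁ = m ∧ n₃ = m))
    (h₂₃ : ¬ (n₂ = m ∧ n₃ = m)) : AtMostOneBlock n₁ n₂ n₃ m := by
  intro r s hrs
  rw [card_I, card_I]
  fin_cases r <;> fin_cases s <;> simp_all <;> tauto

theorem exists_ne_of_card_ne_one {x : Fin (n₁ + n₂ + n₃)}
    (h : (I n₁ n₂ n₃ (block n₁ n₂ n₃ x)).card ≠ 1) :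
    ∃ y, block n₁ n₂ n₃ x = block n₁ n₂ n₃ y ∧ x ≠ y := by
  have hx : x ∈ I n₁ n₂ n₃ (block n₁ n₂ n₃ x) := mem_I.2 rfl
  have hpos := Finset.card_pos.2 ⟨x, hx⟩
  obtain ⟨y, hy, hyx⟩ := Finset.exists_mem_ne (s := I n₁ n₂ n₃ (block n₁ n₂ n₃ x)) (by omega) x
  exact ⟨y, (mem_I.1 hy).symm, hyx.symm⟩

theorem exists_ne_of_card_ne_two {x z : Fin (n₁ + n₂ + n₃)} (hxz : x ≠ z)
    (hb : block n₁ n₂ n₃ x = block n₁ n₂ n₃ z)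
    (h : (I n₁ n₂ n₃ (block n₁ n₂ n₃ x)).card ≠ 2) :
    ∃ y, block n₁ n₂ n₃ x = block n₁ n₂ n₃ y ∧ x ≠ y ∧ z ≠ y := by
  have hsub : ({x, z} : Finset _) ⊆ I n₁ n₂ n₃ (block n₁ n₂ n₃ x) := by
    intro y hy
    simp only [Finset.mem_insert, Finset.mem_singleton] at hy
    rcases hy with rfl | rfl
    · exact mem_I.2 rfl
    · exact mem_I.2 hb.symm
  have h2 := Finset.card_le_card hsub
  rw [Finset.card_pair hxz] at h2
  obtain ⟨y, hy, hyn⟩ := Finset.exists_mem_notMem_of_card_lt_card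
    (s := {x, z}) (t := I n₁ n₂ n₃ (block n₁ n₂ n₃ x)) (by rw [Finset.card_pair hxz]; omega)
  simp only [Finset.mem_insert, Finset.mem_singleton, not_or] at hyn
  exact ⟨y, (mem_I.1 hy).symm, Ne.symm hyn.1, Ne.symm hyn.2⟩

theorem ne_of_block_ne {x y : Fin (n₁ + n₂ + n₃)} (h : block n₁ n₂ n₃ x ≠ block n₁ n₂ n₃ y) :
    x ≠ y := fun e => h (by rw [e])

/-- If `k ≠ p` and `l ≠ q`, a turn moving one of `p`, `q` alone needs a third index in its block.
One of the two blocks has it, since both have at least two elements and not both have exactly two.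
-/
theorem coeff_eq_zero_of_same_blocks (hn : AtMostOneBlock n₁ n₂ n₃ 2)
    {p q k l : Fin (n₁ + n₂ + n₃)} (hpq : block n₁ n₂ n₃ p ≠ block n₁ n₂ n₃ q)
    (hk : block n₁ n₂ n₃ k = block n₁ n₂ n₃ p) (hl : block n₁ n₂ n₃ l = block n₁ n₂ n₃ q)
    (h : ¬ (k = p ∧ l = q)) : coeff M p q k l = 0 := by
  by_cases h1 : k = p
  · subst h1
    exact coeff_eq_zero_of_common M hl.symm (fun e => h ⟨rfl, e.symm⟩) hpq
  by_cases h2 : l = q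
  · subst h2
    rw [coeff_swap_left, coeff_swap_right,
      coeff_eq_zero_of_common M hk.symm (Ne.symm h1) hpq.symm, neg_zero, neg_zero]
  by_cases hc : (I n₁ n₂ n₃ (block n₁ n₂ n₃ p)).card = 2
  · obtain ⟨y, hy, hy1, hy2⟩ := exists_ne_of_card_ne_two (Ne.symm h2) hl.symm (hn _ _ hpq hc)
    rw [coeff_swap_left, coeff_eq_zero_of_left M y hy hy1 (ne_of_block_ne hpq)
      (ne_of_block_ne (by rwa [← hy])) (ne_of_block_ne (by rwa [hk]))
      (ne_of_block_ne (by rwa [hk, ← hy])) h2 hy2, neg_zero]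
  · obtain ⟨y, hy, hy1, hy2⟩ := exists_ne_of_card_ne_two (Ne.symm h1) hk.symm hc
    exact coeff_eq_zero_of_left M y hy hy1 (ne_of_block_ne hpq.symm)
      (ne_of_block_ne (by rw [← hy]; exact hpq.symm)) h1 hy2
      (ne_of_block_ne (by rw [hl]; exact hpq.symm))
      (ne_of_block_ne (by rw [hl, ← hy]; exact hpq.symm))

/-- Each of `q` and `l` is alone in its block among the four indices, and at least one of these
blocks has a second element to turn it with. -/
theorem coeff_eq_zero_of_third_block (hn : AtMostOneBlock n₁ n₂ n₃ 1)
    {p q k l : Fin (n₁ + n₂ + n₃)} (hpq : block n₁ n₂ n₃ p ≠ block n₁ n₂ n₃ q)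
    (hk : block n₁ n₂ n₃ k = block n₁ n₂ n₃ p) (hlp : block n₁ n₂ n₃ l ≠ block n₁ n₂ n₃ p)
    (hlq : block n₁ n₂ n₃ l ≠ block n₁ n₂ n₃ q) : coeff M p q k l = 0 := by
  by_cases hc : (I n₁ n₂ n₃ (block n₁ n₂ n₃ l)).card = 1
  · obtain ⟨y, hy, hy1⟩ := exists_ne_of_card_ne_one (hn _ _ hlq hc)
    rw [coeff_swap_left, coeff_eq_zero_of_left M y hy hy1 (ne_of_block_ne hpq)
      (ne_of_block_ne (by rwa [← hy])) (ne_of_block_ne (by rwa [hk]))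
      (ne_of_block_ne (by rwa [hk, ← hy])) (ne_of_block_ne hlq)
      (ne_of_block_ne (by rwa [← hy])), neg_zero]
  · obtain ⟨y, hy, hy1⟩ := exists_ne_of_card_ne_one hc
    rw [coeff_symm, coeff_swap_left, coeff_eq_zero_of_left M y hy hy1
      (ne_of_block_ne (by rw [hk]; exact hlp.symm))
      (ne_of_block_ne (by rw [hk, ← hy]; exact hlp.symm))
      (ne_of_block_ne hlp.symm) (ne_of_block_ne (by rw [← hy]; exact hlp.symm))
      (ne_of_block_ne hlq.symm) (ne_of_block_ne (by rw [← hy]; exact hlq.symm)), neg_zero]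

/-- Two pairs of distinct blocks out of three always share a block, so swapping indices reduces
everything to the two preceding cases. -/
theorem coeff_eq_zero (hn1 : AtMostOneBlock n₁ n₂ n₃ 1) (hn2 : AtMostOneBlock n₁ n₂ n₃ 2)
    {p q k l : Fin (n₁ + n₂ + n₃)} (hpq : block n₁ n₂ n₃ p ≠ block n₁ n₂ n₃ q)
    (hkl : block n₁ n₂ n₃ k ≠ block n₁ n₂ n₃ l)
    (h1 : ¬ (k = p ∧ l = q)) (h2 : ¬ (k = q ∧ l = p)) : coeff M p q k l = 0 := by
  by_cases hkp : block n₁ n₂ n₃ k = block n₁ n₂ n₃ p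
  · by_cases hlq : block n₁ n₂ n₃ l = block n₁ n₂ n₃ q
    · exact coeff_eq_zero_of_same_blocks M hn2 hpq hkp hlq h1
    · exact coeff_eq_zero_of_third_block M hn1 hpq hkp (fun e => hkl (hkp.trans e.symm)) hlq
  by_cases hkq : block n₁ n₂ n₃ k = block n₁ n₂ n₃ q
  · rw [coeff_swap_left, neg_eq_zero]
    by_cases hlp : block n₁ n₂ n₃ l = block n₁ n₂ n₃ p
    · exact coeff_eq_zero_of_same_blocks M hn2 hpq.symm hkq hlp h2
    · exact coeff_eq_zero_of_third_block M hn1 hpq.symm hkq (fun e => hkl (hkq.trans e.symm)) hlp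
  rw [coeff_swap_right, neg_eq_zero]
  by_cases hlp : block n₁ n₂ n₃ l = block n₁ n₂ n₃ p
  · exact coeff_eq_zero_of_third_block M hn1 hpq hlp hkp hkq
  have hlq : block n₁ n₂ n₃ l = block n₁ n₂ n₃ q := by
    generalize block n₁ n₂ n₃ p = P at *
    generalize block n₁ n₂ n₃ q = Q at *
    generalize block n₁ n₂ n₃ k = K at *
    generalize block n₁ n₂ n₃ l = L at *
    clear h1 h2 hn1 hn2
    revert P Q K L; decide
  rw [coeff_swap_left, neg_eq_zero]
  exact coeff_eq_zero_of_third_block M hn1 hpq.symm hlq hkq hkp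

theorem η_apply {p q k l : Fin (n₁ + n₂ + n₃)} (hkl : block n₁ n₂ n₃ k ≠ block n₁ n₂ n₃ l) :
    (η p q : Mat n₁ n₂ n₃) k l =
      (if p = k ∧ q = l then 1 else 0) - (if q = k ∧ p = l then 1 else 0) := by
  simp only [η, projM, LinearMap.coe_mk, AddHom.coe_mk, Matrix.of_apply, hkl, if_false, ξ,
    Matrix.sub_apply, Matrix.single_apply, and_comm]
  ring

theorem Λ_η (hn1 : AtMostOneBlock n₁ n₂ n₃ 1) (hn2 : AtMostOneBlock n₁ n₂ n₃ 2)
    {p q : Fin (n₁ + n₂ + n₃)} (hpq : block n₁ n₂ n₃ p ≠ block n₁ n₂ n₃ q) :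
    M.Λ (η p q) = (coeff M p q p q / 2) • η p q := by
  ext k l
  -- Pairing with `η k l` gives twice the entry; this is the source of the halves in the
  -- eigenvalues.
  have e : coeff M p q k l = 2 * (M.Λ (η p q) : Mat n₁ n₂ n₃) k l := B_η k l _
  by_cases hkl : block n₁ n₂ n₃ k = block n₁ n₂ n₃ l
  · rw [(M.Λ (η p q)).2.2 k l hkl, ((coeff M p q p q / 2) • η p q).2.2 k l hkl]
  rw [Submodule.coe_smul, Matrix.smul_apply, η_apply hkl, smul_eq_mul]
  have hne := ne_of_block_ne hpq
  by_cases h1 : k = p ∧ l = q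
  · obtain ⟨rfl, rfl⟩ := h1
    simp only [and_self, if_true, hne, hne.symm, if_false]
    linarith
  by_cases h2 : k = q ∧ l = p
  · obtain ⟨rfl, rfl⟩ := h2
    rw [coeff_swap_right] at e
    simp only [and_self, if_true, hne, hne.symm, if_false]
    linarith
  rw [coeff_eq_zero M hn1 hn2 hpq hkl h1 h2] at e
  rw [if_neg (fun h => h1 ⟨h.1.symm, h.2.symm⟩), if_neg (fun h => h2 ⟨h.1.symm, h.2.symm⟩)]
  linarith

theorem Λ_apply (hn1 : AtMostOneBlock n₁ n₂ n₃ 1) (hn2 : AtMostOneBlock n₁ n₂ n₃ 2)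
    (X : 𝔪 n₁ n₂ n₃) {p q : Fin (n₁ + n₂ + n₃)}
    (hpq : block n₁ n₂ n₃ p ≠ block n₁ n₂ n₃ q) :
    (M.Λ X : Mat n₁ n₂ n₃) p q = coeff M p q p q / 2 * (X : Mat n₁ n₂ n₃) p q := by
  have e := B_η p q (M.Λ X)
  rw [M.symm, Λ_η M hn1 hn2 hpq, Submodule.coe_smul, ← bilin_apply, map_smul, bilin_apply, B_η,
    smul_eq_mul] at e
  linarith

theorem coeff_diag_pos {p q : Fin (n₁ + n₂ + n₃)}
    (hpq : block n₁ n₂ n₃ p ≠ block n₁ n₂ n₃ q) : 0 < coeff M p q p q := by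
  refine M.pos _ fun h => ?_
  have e := η_apply (p := p) (q := q) hpq
  rw [h] at e
  simp [ne_of_block_ne hpq, (ne_of_block_ne hpq).symm] at e

theorem coeff_diag_congr {p q p' q' : Fin (n₁ + n₂ + n₃)}
    (hpq : block n₁ n₂ n₃ p ≠ block n₁ n₂ n₃ q) (hp : block n₁ n₂ n₃ p = block n₁ n₂ n₃ p')
    (hq : block n₁ n₂ n₃ q = block n₁ n₂ n₃ q') : coeff M p q p q = coeff M p' q' p' q' := by
  rw [coeff_diag_eq M hp hpq, coeff_swap_left, coeff_swap_right,
    coeff_diag_eq M hq (by rw [← hp]; exact hpq.symm), coeff_swap_left, coeff_swap_right, neg_neg,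
    neg_neg]

theorem InvariantMetric.eq_of_Λ_eq {M M' : InvariantMetric n₁ n₂ n₃} (h : M.Λ = M'.Λ) : M = M' := by
  cases M; cases M'; cases h; rfl

/-- If at most one block has size `1` and at most one has size `2`, every invariant metric belongs
to the three-parameter family. -/
theorem exists_eq_wallachMetric (h₁ : 1 ≤ n₁) (h₂ : 1 ≤ n₂) (h₃ : 1 ≤ n₃)
    (hn1 : AtMostOneBlock n₁ n₂ n₃ 1) (hn2 : AtMostOneBlock n₁ n₂ n₃ 2) :
    ∃ (c₁₂ c₁₃ c₂₃ : ℝ) (h₁₂ : 0 < c₁₂) (h₁₃ : 0 < c₁₃) (h₂₃ : 0 < c₂₃),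
      M = wallachMetric n₁ n₂ n₃ c₁₂ c₁₃ c₂₃ h₁₂ h₁₃ h₂₃ := by
  have ex : ∀ r : Fin 3, ∃ x, block n₁ n₂ n₃ x = r := fun r => by
    have : 0 < (I n₁ n₂ n₃ r).card := by
      rw [card_I]; fin_cases r <;> simp <;> omega
    obtain ⟨x, hx⟩ := Finset.card_pos.1 this
    exact ⟨x, mem_I.1 hx⟩
  obtain ⟨x, hx⟩ := ex 0
  obtain ⟨y, hy⟩ := ex 1
  obtain ⟨z, hz⟩ := ex 2
  have hxy : block n₁ n₂ n₃ x ≠ block n₁ n₂ n₃ y := by rw [hx, hy]; decide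
  have hxz : block n₁ n₂ n₃ x ≠ block n₁ n₂ n₃ z := by rw [hx, hz]; decide
  have hyz : block n₁ n₂ n₃ y ≠ block n₁ n₂ n₃ z := by rw [hy, hz]; decide
  -- Each weight is read off at one representative pair of indices; `coeff_diag_congr` makes the
  -- choice irrelevant.
  refine ⟨coeff M x y x y / 2, coeff M x z x z / 2, coeff M y z y z / 2,
    half_pos (coeff_diag_pos M hxy), half_pos (coeff_diag_pos M hxz),
    half_pos (coeff_diag_pos M hyz), InvariantMetric.eq_of_Λ_eq (LinearMap.ext fun X => ?_)⟩
  ext p q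
  by_cases hpq : block n₁ n₂ n₃ p = block n₁ n₂ n₃ q
  · rw [(M.Λ X).2.2 p q hpq]
    exact (Subtype.property (diagOp n₁ n₂ n₃ _ _ _ X)).2 p q hpq |>.symm
  rw [Λ_apply M hn1 hn2 X hpq]
  change _ = pairWeight _ _ _ _ _ * _
  congr 1
  have sw : ∀ k l, coeff M k l k l = coeff M l k l k := fun k l => by
    rw [coeff_swap_left, coeff_swap_right, neg_neg]
  rcases block_cases p with hp | hp | hp <;> rcases block_cases q with hq | hq | hq
  · exact absurd (hp.trans hq.symm) hpq
  · rw [coeff_diag_congr M hpq (hp.trans hx.symm) (hq.trans hy.symm), hp, hq]; simp [pairWeight]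
  · rw [coeff_diag_congr M hpq (hp.trans hx.symm) (hq.trans hz.symm), hp, hq]; simp [pairWeight]
  · rw [sw, coeff_diag_congr M (Ne.symm hpq) (hq.trans hx.symm) (hp.trans hy.symm), hp, hq]
    simp [pairWeight]
  · exact absurd (hp.trans hq.symm) hpq
  · rw [coeff_diag_congr M hpq (hp.trans hy.symm) (hq.trans hz.symm), hp, hq]; simp [pairWeight]
  · rw [sw, coeff_diag_congr M (Ne.symm hpq) (hq.trans hx.symm) (hp.trans hz.symm), hp, hq]
    simp [pairWeight]
  · rw [sw, coeff_diag_congr M (Ne.symm hpq) (hq.trans hy.symm) (hp.trans hz.symm), hp, hq]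
    simp [pairWeight]
  · exact absurd (hp.trans hq.symm) hpq

end Algebra

/-! ### Calculus for matrix-valued maps -/

section Analysis

-- A submultiplicative norm makes the product rule and the calculus of `exp` available. In finite
-- dimension the choice does not affect smoothness.
attribute [local instance] Matrix.linftyOpNormedRing Matrix.linftyOpNormedAlgebra

variable {n₁ n₂ n₃ : ℕ}

section General

variable {E F : Type*} [NormedAddCommGroup E] [NormedSpace ℝ E] [NormedAddCommGroup F]
  [NormedSpace ℝ F]

theorem hasDerivAt_slice_fst {f : ℝ × ℝ → E} (hf : Differentiable ℝ f) (s t : ℝ) :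
    HasDerivAt (fun s => f (s, t)) (fderiv ℝ f (s, t) (1, 0)) s :=
  (hf (s, t)).hasFDerivAt.comp_hasDerivAt s ((hasDerivAt_id s).prodMk (hasDerivAt_const s t))

theorem hasDerivAt_slice_snd {f : ℝ × ℝ → E} (hf : Differentiable ℝ f) (s t : ℝ) :
    HasDerivAt (fun t => f (s, t)) (fderiv ℝ f (s, t) (0, 1)) t :=
  (hf (s, t)).hasFDerivAt.comp_hasDerivAt t ((hasDerivAt_const t s).prodMk (hasDerivAt_id t))

theorem contDiff_fderiv_const {f : E → F} (hf : ContDiff ℝ ∞ f) (v : E) :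
    ContDiff ℝ ∞ fun p => fderiv ℝ f p v :=
  (hf.fderiv_right (m := ∞) (by simp)).clm_apply contDiff_const

theorem fderiv_fderiv_comm {f : E → F} (hf : ContDiff ℝ ∞ f) (p v w : E) :
    fderiv ℝ (fun q => fderiv ℝ f q v) p w = fderiv ℝ (fun q => fderiv ℝ f q w) p v := by
  have h1 : ContDiff ℝ ∞ (fderiv ℝ f) := hf.fderiv_right (m := ∞) (by simp)
  have h2 : DifferentiableAt ℝ (fderiv ℝ f) p := h1.differentiable (by simp) p
  have e : ∀ v w, fderiv ℝ (fun q => fderiv ℝ f q v) p w = fderiv ℝ (fderiv ℝ f) p w v := by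
    intro v w
    rw [fderiv_clm_apply h2 (differentiableAt_const v)]
    simp
  rw [e, e]
  refine (hf.contDiffAt.isSymmSndFDerivAt ?_) w v
  rw [minSmoothness_of_isRCLikeNormedField]
  exact WithTop.coe_le_coe.2 (le_top : (2 : ℕ∞) ≤ ⊤)

/-- Differentiation under the integral sign for smooth integrands on a compact interval. -/
theorem hasDerivAt_intervalIntegral_of_contDiff {F : ℝ × ℝ → ℝ} (hF : ContDiff ℝ ∞ F)
    (a b s : ℝ) :
    HasDerivAt (fun s => ∫ t in a..b, F (s, t)) (∫ t in a..b, fderiv ℝ F (s, t) (1, 0)) s := by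
  have hd := hF.differentiable (by simp)
  have hc := (contDiff_fderiv_const hF (1, 0)).continuous
  -- Compactness turns continuity of the partial derivative into a constant dominating function.
  obtain ⟨C, hC⟩ := ((isCompact_closedBall s (1 : ℝ)).prod
    (isCompact_uIcc (a := a) (b := b))).exists_bound_of_continuousOn hc.continuousOn
  refine (intervalIntegral.hasDerivAt_integral_of_dominated_loc_of_deriv_le
    (F := fun s t => F (s, t)) (F' := fun s t => fderiv ℝ F (s, t) (1, 0))
    (bound := fun _ => C) (Metric.closedBall_mem_nhds s one_pos) ?_ ?_ ?_ ?_ ?_ ?_).2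
  · exact Filter.Eventually.of_forall fun x =>
      (hF.continuous.comp (by fun_prop)).aestronglyMeasurable
  · exact (hF.continuous.comp (by fun_prop)).intervalIntegrable _ _
  · exact (hc.comp (by fun_prop : Continuous fun t : ℝ => (s, t))).aestronglyMeasurable
  · exact Filter.Eventually.of_forall fun t ht x hx =>
      hC (x, t) ⟨hx, Set.uIoc_subset_uIcc ht⟩
  · exact intervalIntegrable_const
  · exact Filter.Eventually.of_forall fun t _ x _ => hasDerivAt_slice_fst hd x t

end General

variable {E : Type*} [NormedAddCommGroup E] [NormedSpace ℝ E]

/-- A linear map out of the space of matrices, as a continuous linear map. -/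
def clm {F : Type*} [NormedAddCommGroup F] [NormedSpace ℝ F] (L : Mat n₁ n₂ n₃ →ₗ[ℝ] F) :
    Mat n₁ n₂ n₃ →L[ℝ] F := LinearMap.toContinuousLinearMap L

/-- The entries of a matrix. -/
def entry (k l : Fin (n₁ + n₂ + n₃)) : Mat n₁ n₂ n₃ →L[ℝ] ℝ :=
  clm (Matrix.entryLinearMap ℝ ℝ k l)

/-- The transpose. -/
def transposeL (n₁ n₂ n₃ : ℕ) : Mat n₁ n₂ n₃ →L[ℝ] Mat n₁ n₂ n₃ :=
  clm (Matrix.transposeLinearEquiv _ _ ℝ ℝ).toLinearMap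

theorem contDiff_of_entries {f : E → Mat n₁ n₂ n₃} (h : ∀ k l, ContDiff ℝ ∞ fun p => f p k l) :
    ContDiff ℝ ∞ f := by
  have e : f = fun p => ∑ k, ∑ l, f p k l • Matrix.single k l (1 : ℝ) := by
    funext p
    conv_lhs => rw [Matrix.matrix_eq_sum_single (f p)]
    simp [Matrix.smul_single]
  rw [e]
  exact ContDiff.sum fun k _ => ContDiff.sum fun l _ => (h k l).smul contDiff_const

theorem contDiff_entry {f : E → Mat n₁ n₂ n₃} (h : ContDiff ℝ ∞ f) (k l : Fin (n₁ + n₂ + n₃)) :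
    ContDiff ℝ ∞ fun p => f p k l :=
  (entry k l).contDiff.comp h

theorem SmoothLift.contDiff {g : E → G n₁ n₂ n₃} (h : SmoothLift g) :
    ContDiff ℝ ∞ fun p => (g p : Mat n₁ n₂ n₃) :=
  contDiff_of_entries h

theorem smoothLift_of_contDiff {g : E → G n₁ n₂ n₃}
    (h : ContDiff ℝ ∞ fun p => (g p : Mat n₁ n₂ n₃)) : SmoothLift g :=
  fun k l => contDiff_entry h k l

theorem contDiff_transpose {f : E → Mat n₁ n₂ n₃} (h : ContDiff ℝ ∞ f) :
    ContDiff ℝ ∞ fun p => (f p)ᵀ :=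
  (transposeL n₁ n₂ n₃).contDiff.comp h

theorem SmoothLift.mul {g h : E → G n₁ n₂ n₃} (hg : SmoothLift g) (hh : SmoothLift h) :
    SmoothLift fun p => g p * h p :=
  smoothLift_of_contDiff (hg.contDiff.mul hh.contDiff)

theorem SmoothLift.inv {g : E → G n₁ n₂ n₃} (hg : SmoothLift g) :
    SmoothLift fun p => (g p)⁻¹ :=
  smoothLift_of_contDiff (contDiff_transpose hg.contDiff)

theorem SmoothLift.comp {E' : Type*} [NormedAddCommGroup E'] [NormedSpace ℝ E']
    {g : E → G n₁ n₂ n₃} (hg : SmoothLift g) {φ : E' → E} (hφ : ContDiff ℝ ∞ φ) :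
    SmoothLift fun p => g (φ p) :=
  smoothLift_of_contDiff (hg.contDiff.comp hφ)

theorem smoothLift_expG (Z : 𝔪 n₁ n₂ n₃) {φ : E → ℝ} (hφ : ContDiff ℝ ∞ φ) :
    SmoothLift fun p => expG (φ p • Z) := by
  refine smoothLift_of_contDiff ?_
  have h : ContDiff ℝ ∞ (NormedSpace.exp : Mat n₁ n₂ n₃ → Mat n₁ n₂ n₃) :=
    contDiff_iff_contDiffAt.2 fun x => (NormedSpace.exp_analytic (𝕂 := ℝ) x).contDiffAt
  exact h.comp (hφ.smul contDiff_const)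

theorem hasDerivAt_entry {f : ℝ → Mat n₁ n₂ n₃} {f' : Mat n₁ n₂ n₃} {t : ℝ}
    (h : HasDerivAt f f' t) (k l : Fin (n₁ + n₂ + n₃)) :
    HasDerivAt (fun u => f u k l) (f' k l) t :=
  (entry k l).hasFDerivAt.comp_hasDerivAt t h

theorem hasDerivAt_transpose {f : ℝ → Mat n₁ n₂ n₃} {f' : Mat n₁ n₂ n₃} {t : ℝ}
    (h : HasDerivAt f f' t) : HasDerivAt (fun u => (f u)ᵀ) f'ᵀ t :=
  (transposeL n₁ n₂ n₃).hasFDerivAt.comp_hasDerivAt t h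

theorem hasDerivAt_B {f g : ℝ → Mat n₁ n₂ n₃} {f' g' : Mat n₁ n₂ n₃} {t : ℝ}
    (hf : HasDerivAt f f' t) (hg : HasDerivAt g g' t) :
    HasDerivAt (fun u => B (f u) (g u)) (B f' (g t) + B (f t) g') t := by
  have := ((clm (Matrix.traceLinearMap (Fin (n₁ + n₂ + n₃)) ℝ ℝ)).hasFDerivAt.comp_hasDerivAt t
    (hf.mul hg)).neg
  refine this.congr_deriv ?_
  change -(f' * g t + f t * g').trace = _
  rw [Matrix.trace_add, B, B, neg_add]

theorem contDiff_B {f g : E → Mat n₁ n₂ n₃} (hf : ContDiff ℝ ∞ f) (hg : ContDiff ℝ ∞ g) :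
    ContDiff ℝ ∞ fun p => B (f p) (g p) :=
  ((clm (Matrix.traceLinearMap (Fin (n₁ + n₂ + n₃)) ℝ ℝ)).contDiff.comp (hf.mul hg)).neg

theorem velocity_eq {g : ℝ → G n₁ n₂ n₃} {g' : Mat n₁ n₂ n₃} {t : ℝ}
    (h : HasDerivAt (fun u => (g u : Mat n₁ n₂ n₃)) g' t) :
    velocity g t = projM n₁ n₂ n₃ ((g t : Mat n₁ n₂ n₃)ᵀ * g') := by
  have e : (Matrix.of fun k l => deriv (fun u => (g u : Mat n₁ n₂ n₃) k l) t) = g' := by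
    ext k l
    exact (hasDerivAt_entry h k l).deriv
  rw [velocity, e, coe_inv]

/-! ### Independence of the lift and the first variation of energy -/

/-- The energy depends only on the curve in `G/H`. -/
theorem energy_mul (M : InvariantMetric n₁ n₂ n₃) {g k : ℝ → G n₁ n₂ n₃} (hg : SmoothLift g)
    (hk : SmoothLift k) {a b : ℝ} (hab : a < b) (hH : ∀ t ∈ Set.Icc a b, k t ∈ H n₁ n₂ n₃) :
    energy M (fun t => g t * k t) a b = energy M g a b := by
  rw [energy, energy]
  congr 1
  -- Only interior points are used: `k` is known to lie in `H` just on `[a, b]`, so its derivative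
  -- is controlled only inside.
  refine intervalIntegral.integral_congr_Ioo_of_le hab.le fun t ht => ?_
  obtain ⟨g', hg'⟩ : ∃ g', HasDerivAt (fun p => (g p : Mat n₁ n₂ n₃)) g' t :=
    ⟨_, (hg.contDiff.differentiable (by simp) t).hasDerivAt⟩
  obtain ⟨k', hk'⟩ : ∃ k', HasDerivAt (fun p => (k p : Mat n₁ n₂ n₃)) k' t :=
    ⟨_, (hk.contDiff.differentiable (by simp) t).hasDerivAt⟩
  have hkt : k t ∈ H n₁ n₂ n₃ := hH t (Set.Ioo_subset_Icc_self ht)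
  have hkb : IsBlockDiag k' := by
    intro x y hxy
    refine (hasDerivAt_entry hk' x y).unique ?_
    refine (hasDerivAt_const t (0 : ℝ)).congr_of_eventuallyEq ?_
    filter_upwards [Ioo_mem_nhds ht.1 ht.2] with u hu
    exact (hH u (Set.Ioo_subset_Icc_self hu)).1 x y hxy
  -- `(gk)⁻¹(gk)' = k⁻¹(g⁻¹g')k + k⁻¹k'`, and the last term is block diagonal, so the projection
  -- kills it.
  have hv : velocity (fun t => g t * k t) t = Ad ⟨k t, hkt⟩⁻¹ (velocity g t) := by
    rw [velocity_eq (g := fun t => g t * k t) (hg'.mul hk'), velocity_eq hg', Ad_projM]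
    have e : (((⟨k t, hkt⟩⁻¹ : H n₁ n₂ n₃).1 : G n₁ n₂ n₃) : Mat n₁ n₂ n₃) =
      (k t : Mat n₁ n₂ n₃)ᵀ := rfl
    rw [e, Matrix.transpose_transpose]
    have hz : IsBlockDiag ((k t : Mat n₁ n₂ n₃)ᵀ * k') :=
      IsBlockDiag.mul (fun x y hxy => hkt.1 y x hxy.symm) hkb
    have e2 : ((g t * k t : G n₁ n₂ n₃) : Mat n₁ n₂ n₃)ᵀ *
        (g' * (k t : Mat n₁ n₂ n₃) + (g t : Mat n₁ n₂ n₃) * k') =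
        (k t : Mat n₁ n₂ n₃)ᵀ * ((g t : Mat n₁ n₂ n₃)ᵀ * g') * (k t : Mat n₁ n₂ n₃) +
          (k t : Mat n₁ n₂ n₃)ᵀ * k' := by
      change ((g t : Mat n₁ n₂ n₃) * (k t : Mat n₁ n₂ n₃))ᵀ * _ = _
      rw [Matrix.transpose_mul, Matrix.mul_add]
      congr 1
      · simp only [Matrix.mul_assoc]
      · rw [Matrix.mul_assoc, ← Matrix.mul_assoc (g t : Mat n₁ n₂ n₃)ᵀ, transpose_mul_self,
          Matrix.one_mul]
    refine (congrArg (projM n₁ n₂ n₃) e2).trans ?_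
    rw [map_add, hz.projM_eq_zero, add_zero]
  change B (M.Λ (velocity (fun t => g t * k t) t) : Mat n₁ n₂ n₃)
    (velocity (fun t => g t * k t) t) = B (M.Λ (velocity g t) : Mat n₁ n₂ n₃) (velocity g t)
  rw [hv, ← M.equivariant, B_Ad]

theorem hasDerivAt_expG (X : 𝔪 n₁ n₂ n₃) (t : ℝ) :
    HasDerivAt (fun u : ℝ => (expG (u • X) : Mat n₁ n₂ n₃))
      ((expG (t • X) : Mat n₁ n₂ n₃) * (X : Mat n₁ n₂ n₃)) t :=
  hasDerivAt_exp_smul_const (X : Mat n₁ n₂ n₃) t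

/-- The variation field of `(s, t) ↦ g(s, t) H` along `s = 0`, moved to the identity. -/
def variationField (g : ℝ × ℝ → G n₁ n₂ n₃) (t : ℝ) : Mat n₁ n₂ n₃ :=
  (g (0, t) : Mat n₁ n₂ n₃)ᵀ * fderiv ℝ (fun p => (g p : Mat n₁ n₂ n₃)) (0, t) (1, 0)

theorem variationField_eq {g : ℝ × ℝ → G n₁ n₂ n₃} (hg : SmoothLift g) {t : ℝ}
    {W : Mat n₁ n₂ n₃}
    (h : HasDerivAt (fun s => (g (s, t) : Mat n₁ n₂ n₃)) ((g (0, t) : Mat n₁ n₂ n₃) * W) 0) :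
    variationField g t = W := by
  have e := (hasDerivAt_slice_fst (hg.contDiff.differentiable (by simp)) 0 t).unique h
  refine (congrArg ((g (0, t) : Mat n₁ n₂ n₃)ᵀ * ·) e).trans ?_
  change (g (0, t) : Mat n₁ n₂ n₃)ᵀ * ((g (0, t) : Mat n₁ n₂ n₃) * W) = W
  rw [← Matrix.mul_assoc, transpose_mul_self, Matrix.one_mul]

/-- At a fixed end point `g(0,t)⁻¹ g(s,t)` stays in `H`, whose off-diagonal blocks vanish. This
removes the boundary terms. -/
theorem variationField_isBlockDiag {g : ℝ × ℝ → G n₁ n₂ n₃} (hg : SmoothLift g) {t : ℝ}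
    (h : ∀ s, (g (s, t) : G n₁ n₂ n₃ ⧸ H n₁ n₂ n₃) = (g (0, t) : G n₁ n₂ n₃ ⧸ H n₁ n₂ n₃)) :
    IsBlockDiag (variationField g t) := by
  intro k l hkl
  have hd := (hasDerivAt_const (0 : ℝ) ((g (0, t) : Mat n₁ n₂ n₃)ᵀ)).mul
    (hasDerivAt_slice_fst (hg.contDiff.differentiable (by simp)) 0 t)
  have he := hasDerivAt_entry hd k l
  rw [zero_mul, zero_add] at he
  refine he.unique ((hasDerivAt_const (0 : ℝ) (0 : ℝ)).congr_of_eventuallyEq ?_)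
  refine Filter.Eventually.of_forall fun s => ?_
  exact (QuotientGroup.eq.1 (h s).symm).1 k l hkl

/-- With `U = g⁻¹∂_t g` and `W = g⁻¹∂_s g`, the structure equation at `s = 0` reads `∂_s U = W' +
[X, W]`. Since `ΛX` is constant in `t`, the `W'` part integrates to the boundary term; the
invariance of `B` rewrites the other part. -/
theorem hasDerivAt_energy (M : InvariantMetric n₁ n₂ n₃) (X : 𝔪 n₁ n₂ n₃)
    {g : ℝ × ℝ → G n₁ n₂ n₃} (hg : SmoothLift g) (hX : ∀ t, g (0, t) = expG (t • X)) (a b : ℝ) :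
    HasDerivAt (fun s => energy M (fun t => g (s, t)) a b)
      (B (M.Λ X : Mat n₁ n₂ n₃) (variationField g b) -
        B (M.Λ X : Mat n₁ n₂ n₃) (variationField g a) +
        ∫ t in a..b, B ⁅(M.Λ X : Mat n₁ n₂ n₃), (X : Mat n₁ n₂ n₃)⁆ (variationField g t)) 0 := by
  set f : ℝ × ℝ → Mat n₁ n₂ n₃ := fun p => (g p : Mat n₁ n₂ n₃) with hf_def
  have hf : ContDiff ℝ ∞ f := hg.contDiff
  have hfd := hf.differentiable (by simp)
  set fs : ℝ × ℝ → Mat n₁ n₂ n₃ := fun p => fderiv ℝ f p (1, 0) with hfs_def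
  set ft : ℝ × ℝ → Mat n₁ n₂ n₃ := fun p => fderiv ℝ f p (0, 1) with hft_def
  have hfs : ContDiff ℝ ∞ fs := contDiff_fderiv_const hf _
  have hft : ContDiff ℝ ∞ ft := contDiff_fderiv_const hf _
  set U : ℝ × ℝ → Mat n₁ n₂ n₃ := fun p => (f p)ᵀ * ft p with hU_def
  have hU : ContDiff ℝ ∞ U := (contDiff_transpose hf).mul hft
  set P : Mat n₁ n₂ n₃ →L[ℝ] Mat n₁ n₂ n₃ :=
    clm ((𝔪 n₁ n₂ n₃).subtype ∘ₗ projM n₁ n₂ n₃) with hP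
  set L : Mat n₁ n₂ n₃ →L[ℝ] Mat n₁ n₂ n₃ :=
    clm ((𝔪 n₁ n₂ n₃).subtype ∘ₗ M.Λ ∘ₗ projM n₁ n₂ n₃) with hL
  set q : ℝ × ℝ → ℝ := fun p => B (L (U p)) (P (U p)) with hq_def
  have hq : ContDiff ℝ ∞ q := contDiff_B (L.contDiff.comp hU) (P.contDiff.comp hU)
  have henergy : (fun s => energy M (fun t => g (s, t)) a b) =
      fun s => (1 / 2) * ∫ t in a..b, q (s, t) := by
    funext s
    rw [energy]
    congr 1
    refine intervalIntegral.integral_congr fun t _ => ?_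
    have hv := velocity_eq (g := fun t => g (s, t)) (hasDerivAt_slice_snd hfd s t)
    change B (M.Λ (velocity (fun t => g (s, t)) t) : Mat n₁ n₂ n₃)
      (velocity (fun t => g (s, t)) t) = _
    rw [hv]
    rfl
  have hft0 : ∀ t, ft (0, t) = f (0, t) * (X : Mat n₁ n₂ n₃) := fun t => by
    refine (hasDerivAt_slice_snd hfd 0 t).unique ?_
    have := hasDerivAt_expG X t
    rw [← hX t] at this
    refine this.congr_of_eventuallyEq (Filter.Eventually.of_forall fun u => ?_)
    simp only [hf_def, hX u]
  have hff : ∀ p, (f p)ᵀ * f p = 1 := fun p => transpose_mul_self (g p)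
  have hU0 : ∀ t, U (0, t) = X := fun t => by
    simp only [hU_def]
    rw [hft0, ← Matrix.mul_assoc, hff, Matrix.one_mul]
  set W := variationField g with hW_def
  have hW : ∀ t, W t = (f (0, t))ᵀ * fs (0, t) := fun t => rfl
  -- Differentiate `gᵀg = 1` in `s`.
  have hskew : ∀ t, (fs (0, t))ᵀ * f (0, t) = -W t := fun t => by
    have h1 := (hasDerivAt_transpose (hasDerivAt_slice_fst hfd 0 t)).mul
      (hasDerivAt_slice_fst hfd 0 t)
    have h2 : HasDerivAt (fun s => (f (s, t))ᵀ * f (s, t)) 0 0 := by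
      simp only [hff]; exact hasDerivAt_const _ _
    exact eq_neg_of_add_eq_zero_left (h1.unique h2)
  set fst : ℝ × ℝ → Mat n₁ n₂ n₃ := fun p => fderiv ℝ ft p (1, 0) with hfst_def
  have hfst : ContDiff ℝ ∞ fst := contDiff_fderiv_const hft _
  set W' : ℝ → Mat n₁ n₂ n₃ := fun t =>
    (ft (0, t))ᵀ * fs (0, t) + (f (0, t))ᵀ * fst (0, t) with hW'_def
  have hWd : ∀ t, HasDerivAt W (W' t) t := fun t => by
    have h1 := (hasDerivAt_transpose (hasDerivAt_slice_snd hfd 0 t)).mul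
      (hasDerivAt_slice_snd (hfs.differentiable (by simp)) 0 t)
    -- Equality of mixed partials lets the same term `fst` appear in `W'` and in `∂_s U`.
    exact h1.congr_deriv (congrArg (fun Z => (ft (0, t))ᵀ * fs (0, t) + (f (0, t))ᵀ * Z)
      (fderiv_fderiv_comm hf (0, t) (1, 0) (0, 1)))
  have hUd : ∀ t, HasDerivAt (fun s => U (s, t)) (W' t + ⁅(X : Mat n₁ n₂ n₃), W t⁆) 0 := fun t => by
    have h1 := (hasDerivAt_transpose (hasDerivAt_slice_fst hfd 0 t)).mul
      (hasDerivAt_slice_fst (hft.differentiable (by simp)) 0 t)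
    refine h1.congr_deriv ?_
    change (fs (0, t))ᵀ * ft (0, t) + (f (0, t))ᵀ * fst (0, t) = _
    simp only [hW'_def]
    rw [hft0, ← Matrix.mul_assoc, hskew, Matrix.transpose_mul, X.2.1, Matrix.mul_assoc _ _ (fs _),
      ← hW, Ring.lie_def]
    noncomm_ring
  -- Symmetry of `Λ` makes the two product-rule terms equal; the 2 cancels the `1 / 2` in the
  -- energy.
  have hqd : ∀ t, fderiv ℝ q (0, t) (1, 0) = 2 * (B (M.Λ X : Mat n₁ n₂ n₃) (W' t) +
      B ⁅(M.Λ X : Mat n₁ n₂ n₃), (X : Mat n₁ n₂ n₃)⁆ (W t)) := fun t => by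
    have h1 := hasDerivAt_B (L.hasFDerivAt.comp_hasDerivAt 0 (hUd t))
      (P.hasFDerivAt.comp_hasDerivAt 0 (hUd t))
    have e := (hasDerivAt_slice_fst (hq.differentiable (by simp)) 0 t).unique h1
    rw [e, ← B_lie]
    set D := W' t + ⁅(X : Mat n₁ n₂ n₃), W t⁆ with hD
    change B (M.Λ (projM n₁ n₂ n₃ D) : Mat n₁ n₂ n₃) (projM n₁ n₂ n₃ (U (0, t))) +
      B (M.Λ (projM n₁ n₂ n₃ (U (0, t))) : Mat n₁ n₂ n₃) (projM n₁ n₂ n₃ D) = _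
    rw [hU0, projM_coe, M.symm, B_comm, B_projM, hD, ← bilin_apply, map_add, bilin_apply,
      bilin_apply]
    ring
  have hW'c : Continuous W' := by
    have c : Continuous fun t : ℝ => ((0 : ℝ), t) := by fun_prop
    exact (((contDiff_transpose hft).mul hfs).add
      ((contDiff_transpose hf).mul hfst)).continuous.comp c
  have hWc : Continuous W := continuous_iff_continuousAt.2 fun t => (hWd t).continuousAt
  have hBc : ∀ (Y : Mat n₁ n₂ n₃) {V : ℝ → Mat n₁ n₂ n₃}, Continuous V →
      Continuous fun t => B Y (V t) := fun Y V hV =>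
    (clm (bilin n₁ n₂ n₃ Y)).continuous.comp hV
  have hftc := intervalIntegral.integral_eq_sub_of_hasDerivAt (a := a) (b := b)
    (f := fun t => B (M.Λ X : Mat n₁ n₂ n₃) (W t))
    (f' := fun t => B (M.Λ X : Mat n₁ n₂ n₃) (W' t))
    (fun t _ => (clm (bilin n₁ n₂ n₃ (M.Λ X))).hasFDerivAt.comp_hasDerivAt t (hWd t))
    ((hBc _ hW'c).intervalIntegrable _ _)
  rw [henergy]
  refine ((hasDerivAt_intervalIntegral_of_contDiff hq a b 0).const_mul (1 / 2)).congr_deriv ?_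
  simp only [hqd]
  rw [intervalIntegral.integral_const_mul, intervalIntegral.integral_add
    ((hBc _ hW'c).intervalIntegrable _ _) ((hBc _ hWc).intervalIntegrable _ _), hftc]
  ring

/-! ### Geodesics and the vanishing of `[ΛX, X]` -/

theorem isGeodesic_orbitCurve (M : InvariantMetric n₁ n₂ n₃) (X : 𝔪 n₁ n₂ n₃)
    (h : ⁅(M.Λ X : Mat n₁ n₂ n₃), (X : Mat n₁ n₂ n₃)⁆ = 0) : IsGeodesic M (orbitCurve X) := by
  refine ⟨⟨fun t => expG (t • X), smoothLift_expG X contDiff_id, fun t => rfl⟩, ?_⟩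
  intro a b hab g hg h0 hends
  have hk : SmoothLift fun t : ℝ => (g (0, t))⁻¹ * expG (t • X) :=
    (hg.comp (φ := fun t : ℝ => ((0 : ℝ), t)) (by fun_prop)).inv.mul (smoothLift_expG X contDiff_id)
  -- A variation lifts the orbit only modulo `H`. Right multiplication by `k` makes the central
  -- curve exactly `exp(tX)` and leaves the energy on `[a, b]` unchanged.
  set k : ℝ → G n₁ n₂ n₃ := fun t => (g (0, t))⁻¹ * expG (t • X) with hk_def
  have hkH : ∀ t ∈ Set.Icc a b, k t ∈ H n₁ n₂ n₃ := fun t ht => QuotientGroup.eq.1 (h0 t ht)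
  set g₁ : ℝ × ℝ → G n₁ n₂ n₃ := fun p => g p * k p.2 with hg₁_def
  have hg₁ : SmoothLift g₁ := hg.mul (hk.comp contDiff_snd)
  have hE : (fun s => energy M (fun t => g (s, t)) a b) =
      fun s => energy M (fun t => g₁ (s, t)) a b := by
    funext s
    exact (energy_mul M (hg.comp (φ := fun t : ℝ => (s, t)) (by fun_prop)) hk hab hkH).symm
  have hend : ∀ t ∈ Set.Icc a b,
      (∀ s, (g (s, t) : G n₁ n₂ n₃ ⧸ H n₁ n₂ n₃) = orbitCurve X t) →
      IsBlockDiag (variationField g₁ t) := by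
    intro t ht hs
    have e : ∀ s, (g₁ (s, t) : G n₁ n₂ n₃ ⧸ H n₁ n₂ n₃) = orbitCurve X t := fun s => by
      rw [← hs s]
      exact QuotientGroup.mk_mul_of_mem _ (hkH t ht)
    exact variationField_isBlockDiag hg₁ fun s => (e s).trans (e 0).symm
  rw [hE]
  refine (hasDerivAt_energy M X hg₁ (fun t => ?_) a b).congr_deriv ?_
  · simp [hg₁_def, hk_def]
  · rw [B_isBlockDiag _ (hend a (Set.left_mem_Icc.2 hab.le) fun s => (hends s).1),
      B_isBlockDiag _ (hend b (Set.right_mem_Icc.2 hab.le) fun s => (hends s).2), h]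
    simp [B]

theorem expG_zero : expG (0 : 𝔪 n₁ n₂ n₃) = 1 :=
  Subtype.ext (by simp [expG])

/-- The variation `exp(tX) exp(s t(1-t) Z)` on `[0, 1]` fixes the end points and has field `t(1-t)
Z`. Criticality gives `B(Z, Z) / 6 = 0`, and `B` is definite on skew matrices. -/
theorem lie_eq_zero_of_isGeodesic (M : InvariantMetric n₁ n₂ n₃) (X Z : 𝔪 n₁ n₂ n₃)
    (hZ : (Z : Mat n₁ n₂ n₃) = ⁅(M.Λ X : Mat n₁ n₂ n₃), (X : Mat n₁ n₂ n₃)⁆)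
    (h : IsGeodesic M (orbitCurve X)) : Z = 0 := by
  set g : ℝ × ℝ → G n₁ n₂ n₃ :=
    fun p => expG (p.2 • X) * expG ((p.1 * (p.2 * (1 - p.2))) • Z) with hg_def
  have hg : SmoothLift g :=
    (smoothLift_expG X contDiff_snd).mul (smoothLift_expG Z (by fun_prop))
  have hg0 : ∀ t, g (0, t) = expG (t • X) := fun t => by
    simp [hg_def, expG_zero]
  have hE := h.2 0 1 zero_lt_one g hg (fun t _ => by rw [hg0]; rfl) fun s => by
    constructor <;> simp [hg_def, expG_zero, orbitCurve]
  have hV : ∀ t, variationField g t = (t * (1 - t)) • (Z : Mat n₁ n₂ n₃) := fun t => by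
    refine variationField_eq hg ?_
    have h1 : HasDerivAt (fun s : ℝ => s * (t * (1 - t))) (t * (1 - t)) 0 := by
      simpa using (hasDerivAt_id (0 : ℝ)).mul_const (t * (1 - t))
    have h2 := (hasDerivAt_expG Z (0 * (t * (1 - t)))).scomp (0 : ℝ) h1
    have h3 := (hasDerivAt_const (0 : ℝ) (expG (t • X) : Mat n₁ n₂ n₃)).mul h2
    refine h3.congr_deriv ?_
    rw [hg0]
    simp [expG_zero]
  have e := (hasDerivAt_energy M X hg hg0 0 1).unique hE
  simp only [hV, ← hZ] at e
  have hs : ∀ (Y : Mat n₁ n₂ n₃) (c : ℝ), B Y (c • (Z : Mat n₁ n₂ n₃)) = c * B Y Z := fun Y c =>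
    map_smul (bilin n₁ n₂ n₃ Y) c (Z : Mat n₁ n₂ n₃)
  simp only [hs] at e
  rw [intervalIntegral.integral_mul_const] at e
  have hi : ∫ t in (0 : ℝ)..1, t * (1 - t) = 1 / 6 := by
    have : (fun t : ℝ => t * (1 - t)) = fun t => t - t ^ 2 := by funext t; ring
    rw [this, intervalIntegral.integral_sub (by simp) (by simp)]
    simp; norm_num
  rw [hi] at e
  refine Subtype.ext (eq_zero_of_B_self Z.2.1 ?_)
  linarith

end Analysis

/-! ### The two equivalences -/

theorem isWallachEquigeodesicVector_iff {n₁ n₂ n₃ : ℕ} (X : 𝔪 n₁ n₂ n₃) :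
    IsWallachEquigeodesicVector X ↔
      IsBlockDiag ((X : Mat n₁ n₂ n₃) * (X : Mat n₁ n₂ n₃)) := by
  constructor
  · intro h
    -- The single metric with weights 1, 2, 3 suffices: the weights are distinct, so no factor `λ_rt
    -- - λ_ts` vanishes.
    refine isBlockDiag_sq_of_lie_diagOp_eq_zero ?_
    have hm := lie_mem (Y := diagOp n₁ n₂ n₃ 1 2 3 X) (X := X)
      fun k l hkl => lie_diagOp_apply_of_block_eq 1 2 3 X hkl
    exact congrArg Subtype.val (lie_eq_zero_of_isGeodesic _ X ⟨_, hm⟩ rfl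
      (h 1 2 3 one_pos two_pos three_pos))
  · intro h c₁₂ c₁₃ c₂₃ h₁₂ h₁₃ h₂₃
    exact isGeodesic_orbitCurve _ X (lie_diagOp_eq_zero h c₁₂ c₁₃ c₂₃)

end GenWallach

end

theorem mainTheorem10 (n₁ n₂ n₃ : ℕ) (h₁ : 1 ≤ n₁) (h₂ : 1 ≤ n₂) (h₃ : 1 ≤ n₃)
    (a : Fin (n₁ + n₂ + n₃) → Fin (n₁ + n₂ + n₃) → ℝ) (X : 𝔪 n₁ n₂ n₃)
    (hX : (X : Mat n₁ n₂ n₃) = component 0 1 a + component 0 2 a + component 1 2 a) :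
    (IsWallachEquigeodesicVector X ↔
      (∀ p ∈ I n₁ n₂ n₃ 1, ∀ q ∈ I n₁ n₂ n₃ 2, pairing 0 1 0 2 a p q = 0) ∧
      (∀ p ∈ I n₁ n₂ n₃ 0, ∀ q ∈ I n₁ n₂ n₃ 2, pairing 0 1 1 2 a p q = 0) ∧
      (∀ p ∈ I n₁ n₂ n₃ 0, ∀ q ∈ I n₁ n₂ n₃ 1, pairing 0 2 1 2 a p q = 0)) ∧
    ((¬ (n₁ = 1 ∧ n₂ = 1) ∧ ¬ (n₁ = 1 ∧ n₃ = 1) ∧ ¬ (n₂ = 1 ∧ n₃ = 1) ∧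
      ¬ (n₁ = 2 ∧ n₂ = 2) ∧ ¬ (n₁ = 2 ∧ n₃ = 2) ∧ ¬ (n₂ = 2 ∧ n₃ = 2)) →
      (IsEquigeodesicVector X ↔
        (∀ p ∈ I n₁ n₂ n₃ 1, ∀ q ∈ I n₁ n₂ n₃ 2, pairing 0 1 0 2 a p q = 0) ∧
        (∀ p ∈ I n₁ n₂ n₃ 0, ∀ q ∈ I n₁ n₂ n₃ 2, pairing 0 1 1 2 a p q = 0) ∧
        (∀ p ∈ I n₁ n₂ n₃ 0, ∀ q ∈ I n₁ n₂ n₃ 1, pairing 0 2 1 2 a p q = 0))) := by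
  rw [system_iff_sq_isBlockDiag a X hX]
  refine ⟨isWallachEquigeodesicVector_iff X, ?_⟩
  rintro ⟨h1, h2, h3, h4, h5, h6⟩
  rw [← isWallachEquigeodesicVector_iff X]
  constructor
  · intro h c₁₂ c₁₃ c₂₃ h₁₂ h₁₃ h₂₃
    exact h _
  · intro h M
    obtain ⟨c₁₂, c₁₃, c₂₃, h₁₂, h₁₃, h₂₃, rfl⟩ := exists_eq_wallachMetric M h₁ h₂ h₃
      (atMostOneBlock h1 h2 h3) (atMostOneBlock h4 h5 h6)
    exact h c₁₂ c₁₃ c₂₃ h₁₂ h₁₃ h₂₃
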